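/- **Setting.** All Hilbert spaces are complex and all operators are bounded. Let $$\mathbb E=\{(x_1,x_2,x_3)\in\mathbb C^3:\ 1-zx_1-wx_2+zwx_3\neq 0 \text{ whenever } |z|\le 1,\ |w|\le 1\}$$ be the tetrablock, and let $b\mathbb E=\{(x_1,x_2,x_3):\ x_1=\bar x_2x_3,\ |x_3|=1,\ |x_2|\le 1\}$. Write $\sigma_T$ for the Taylor joint spectrum and $[S_1,S_2]=S_1S_2-S_2S_1$. A commuting triple $(T_1,T_2,T_3)$ of operators on a Hilbert space is * an *$\mathbb E$-contraction* if $\sigma_T(T_1,T_2,T_3)\subseteq\overline{\mathbb E}$ and $\|p(T_1,T_2,T_3)\|\le\sup_{\overline{\mathbb E}}|p|$ for every polynomial $p\in\mathbb C[x_1,x_2,x_3]$; it is *pure* if $T_3^{*n}\to 0$ strongly as $n\to\infty$; * an *$\mathbb E$-unitary* if $T_1,T_2,T_3$ are normal and $\sigma_T(T_1,T_2,T_3)\subseteq b\mathbb E$; * an *$\mathbb E$-isometry* if it is the restriction of an $\mathbb E$-unitary to a common invariant (closed) subspace; it is *pure* if $T_3$ is a pure isometry, i.e. an isometry with $T_3^{*n}\to0$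 strongly. For a contraction $T$ put $D_T=(I-T^*T)^{1/2}$ and $\mathcal D_T=\overline{\operatorname{Ran}}\,D_T$. The *fundamental operators* of an $\mathbb E$-contraction $(T_1,T_2,T_3)$ are the operators $A_1,A_2$ on $\mathcal D_{T_3}$ with $T_1-T_2^*T_3=D_{T_3}A_1D_{T_3}$ and $T_2-T_1^*T_3=D_{T_3}A_2D_{T_3}$. An *$\mathbb E$-isometric dilation* of an $\mathbb E$-contraction $(T_1,T_2,T)$ on $\mathcal H$ is an $\mathbb E$-isometry $(Q_1,Q_2,V)$ on a Hilbert space $\mathcal K$ together with an isometry $W:\mathcal H\to\mathcal K$ such that $W^*Q_1^{m_1}Q_2^{m_2}V^nW=T_1^{m_1}T_2^{m_2}T^n$ for all integers $m_1,m_2,n\ge 0$; it is *minimal* if $\mathcal K=\overline{\operatorname{span}}\{Q_1^{m_1}Q_2^{m_2}V^nWh:\ h\in\mathcal H,\ m_1,m_2,n\ge0\}$. **Theorem 3.2.** Let $(T_1,T_2,T)$ be a pure $\mathbb E$-contraction on a Hilbert space $\mathcal H$, and let the fundamental operators $A_{1*},A_{2*}$ of $(T_1^*,T_2^*,T^*)$,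 which act on $\mathcal D_{T^*}$, satisfy $[A_{1*},A_{2*}]=0$ and $[A_{1*}^*,A_{1*}]=[A_{2*}^*,A_{2*}]$. On $\mathcal K=H^2(\mathbb D)\otimes\mathcal D_{T^*}$ (Hilbert space tensor product, with $M_z$ the operator of multiplication by $z$ on the Hardy space $H^2(\mathbb D)$) define $$Q_1=I\otimes A_{1*}^*+M_z\otimes A_{2*},\qquad Q_2=I\otimes A_{2*}^*+M_z\otimes A_{1*},\qquad V=M_z\otimes I .$$ Then $(Q_1,Q_2,V)$ is a pure $\mathbb E$-isometry, and there is an isometry $W:\mathcal H\to\mathcal K$ through which $(Q_1,Q_2,V)$ is a minimal $\mathbb E$-isometric dilation of $(T_1,T_2,T)$. -/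

import Mathlib

open scoped InnerProduct TensorProduct Topology ENNReal ComplexConjugate

universe u

namespace Tetrablock

/-! ### The tetrablock -/

/-- The tetrablock `𝔼 ⊆ ℂ³`. -/
def tetrablock : Set (Fin 3 → ℂ) :=
  {x | ∀ z w : ℂ, ‖z‖ ≤ 1 → ‖w‖ ≤ 1 → 1 - z * x 0 - w * x 1 + z * w * x 2 ≠ 0}

/-- The distinguished boundary `b𝔼` of the tetrablock. -/
def distinguishedBoundary : Set (Fin 3 → ℂ) :=
  {x | x 0 = conj (x 1) * x 2 ∧ ‖x 2‖ = 1 ∧ ‖x 1‖ ≤ 1}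

/-! ### The Taylor joint spectrum of a triple of operators -/

section Taylor

variable {X : Type*} [NormedAddCommGroup X] [NormedSpace ℂ X]

/-- First map `Λ⁰ → Λ¹` of the Koszul complex `0 → X → X³ → X³ → X → 0` of `(S₁, S₂, S₃)`. -/
def koszul₁ (S₁ S₂ S₃ : X →L[ℂ] X) : X → X × X × X :=
  fun x => (S₁ x, S₂ x, S₃ x)

/-- Second map `Λ¹ → Λ²` of the Koszul complex; the coordinates of `Λ²` belong to
`e₁ ∧ e₂`, `e₁ ∧ e₃`, `e₂ ∧ e₃`. -/
def koszul₂ (S₁ S₂ S₃ : X →L[ℂ] X) : X × X × X → X × X × X :=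
  fun x => (S₁ x.2.1 - S₂ x.1, S₁ x.2.2 - S₃ x.1, S₂ x.2.2 - S₃ x.2.1)

/-- Third map `Λ² → Λ³` of the Koszul complex. -/
def koszul₃ (S₁ S₂ S₃ : X →L[ℂ] X) : X × X × X → X :=
  fun y => S₁ y.2.2 - S₂ y.2.1 + S₃ y.1

/-- A (commuting) triple is Taylor regular if its Koszul complex is exact. -/
def IsTaylorRegular (S₁ S₂ S₃ : X →L[ℂ] X) : Prop :=
  Function.Injective (koszul₁ S₁ S₂ S₃) ∧
  Function.Exact (koszul₁ S₁ S₂ S₃) (koszul₂ S₁ S₂ S₃) ∧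
  Function.Exact (koszul₂ S₁ S₂ S₃) (koszul₃ S₁ S₂ S₃) ∧
  Function.Surjective (koszul₃ S₁ S₂ S₃)

/-- The Taylor joint spectrum `σ_T(T₁, T₂, T₃)` of a (commuting) triple. -/
def taylorSpectrum (T₁ T₂ T₃ : X →L[ℂ] X) : Set (Fin 3 → ℂ) :=
  {l | ¬ IsTaylorRegular (T₁ - l 0 • 1) (T₂ - l 1 • 1) (T₃ - l 2 • 1)}

/-- The value `p(T₁, T₂, T₃)` of a polynomial at a (commuting) triple. -/
def polyEval (p : MvPolynomial (Fin 3) ℂ) (T₁ T₂ T₃ : X →L[ℂ] X) : X →L[ℂ] X :=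
  ∑ m ∈ p.support, p.coeff m • (T₁ ^ m 0 * T₂ ^ m 1 * T₃ ^ m 2)

end Taylor

/-! ### Classes of operator triples -/

section Classes

variable {H : Type u} [NormedAddCommGroup H] [InnerProductSpace ℂ H] [CompleteSpace H]

/-- The three operators commute pairwise. -/
def IsCommutingTriple (T₁ T₂ T₃ : H →L[ℂ] H) : Prop :=
  Commute T₁ T₂ ∧ Commute T₁ T₃ ∧ Commute T₂ T₃

/-- An `𝔼`-contraction: a commuting triple that has the closed tetrablock as a spectral set. -/
structure IsEContraction (T₁ T₂ T₃ : H →L[ℂ] H) : Prop where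
  commuting : IsCommutingTriple T₁ T₂ T₃
  spectrum_subset : taylorSpectrum T₁ T₂ T₃ ⊆ closure tetrablock
  von_neumann : ∀ p : MvPolynomial (Fin 3) ℂ,
    ‖polyEval p T₁ T₂ T₃‖ ≤ sSup ((fun x => ‖MvPolynomial.eval x p‖) '' closure tetrablock)

/-- An `𝔼`-unitary: a commuting triple of normal operators with joint spectrum in `b𝔼`. -/
structure IsEUnitary (N₁ N₂ N₃ : H →L[ℂ] H) : Prop where
  commuting : IsCommutingTriple N₁ N₂ N₃
  normal₁ : IsStarNormal N₁
  normal₂ : IsStarNormal N₂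
  normal₃ : IsStarNormal N₃
  spectrum_subset : taylorSpectrum N₁ N₂ N₃ ⊆ distinguishedBoundary

/-- An `𝔼`-isometry: a commuting triple which is the restriction of an `𝔼`-unitary to a
common invariant subspace. The inclusion of `H` into the larger Hilbert space is the isometry
`J`. -/
def IsEIsometry (V₁ V₂ V₃ : H →L[ℂ] H) : Prop :=
  IsCommutingTriple V₁ V₂ V₃ ∧
  ∃ (K : Type u) (_ : NormedAddCommGroup K) (_ : InnerProductSpace ℂ K) (_ : CompleteSpace K)
    (N₁ N₂ N₃ : K →L[ℂ] K) (J : H →ₗᵢ[ℂ] K),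
    IsEUnitary N₁ N₂ N₃ ∧
    ∀ h, N₁ (J h) = J (V₁ h) ∧ N₂ (J h) = J (V₂ h) ∧ N₃ (J h) = J (V₃ h)

/-- A pure contraction: a contraction `T` with `T*ⁿ → 0` strongly. -/
def IsPureContraction (T : H →L[ℂ] H) : Prop :=
  ‖T‖ ≤ 1 ∧ ∀ h, Filter.Tendsto (fun n : ℕ => ((T†) ^ n) h) Filter.atTop (𝓝 0)

/-- A pure `𝔼`-contraction. -/
def IsPureEContraction (T₁ T₂ T₃ : H →L[ℂ] H) : Prop :=
  IsEContraction T₁ T₂ T₃ ∧ IsPureContraction T₃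

/-- A pure `𝔼`-isometry: an `𝔼`-isometry whose last entry is a pure isometry. -/
def IsPureEIsometry (V₁ V₂ V₃ : H →L[ℂ] H) : Prop :=
  IsEIsometry V₁ V₂ V₃ ∧ Isometry V₃ ∧ IsPureContraction V₃

/-! ### Defect operators and fundamental operators -/

/-- The defect operator `D_T = (I - T*T)^{1/2}`. -/
noncomputable def defectOp (T : H →L[ℂ] H) : H →L[ℂ] H :=
  CFC.sqrt (1 - T† * T)

/-- The defect space `𝒟_T`, the closure of the range of `D_T`. -/
noncomputable abbrev defectSpace (T : H →L[ℂ] H) : Submodule ℂ H :=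
  (LinearMap.range (defectOp T).toLinearMap).topologicalClosure

/-- `D_T` as an operator from `H` into `𝒟_T`. -/
noncomputable def defectMap (T : H →L[ℂ] H) : H →L[ℂ] defectSpace T :=
  (defectOp T).codRestrict (defectSpace T) fun x =>
    Submodule.le_topologicalClosure _ (LinearMap.mem_range_self _ x)

/-- `A₁, A₂` are the fundamental operators of `(T₁, T₂, T₃)`: the operators on `𝒟_{T₃}` with
`T₁ - T₂* T₃ = D_{T₃} A₁ D_{T₃}` and `T₂ - T₁* T₃ = D_{T₃} A₂ D_{T₃}`. -/
def AreFundamentalOperators (T₁ T₂ T₃ : H →L[ℂ] H)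
    (A₁ A₂ : defectSpace T₃ →L[ℂ] defectSpace T₃) : Prop :=
  (∀ h, T₁ h - (T₂†) (T₃ h) = defectOp T₃ (A₁ (defectMap T₃ h) : H)) ∧
  (∀ h, T₂ h - (T₁†) (T₃ h) = defectOp T₃ (A₂ (defectMap T₃ h) : H))

/-! ### Dilations -/

variable {K : Type u} [NormedAddCommGroup K] [InnerProductSpace ℂ K] [CompleteSpace K]

/-- `(Q₁, Q₂, V)` on `K` is an `𝔼`-isometric dilation of `(T₁, T₂, T₃)` on `H`, where `H` is
regarded as a subspace of `K` through the isometry `W` (so that `W†` is the orthogonal projection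
of `K` onto `H`). -/
def IsEIsometricDilation (W : H →ₗᵢ[ℂ] K) (T₁ T₂ T₃ : H →L[ℂ] H) (Q₁ Q₂ V : K →L[ℂ] K) : Prop :=
  IsEIsometry Q₁ Q₂ V ∧
  ∀ (m₁ m₂ n : ℕ) (h : H),
    (W.toContinuousLinearMap†) ((Q₁ ^ m₁ * Q₂ ^ m₂ * V ^ n) (W h)) =
      (T₁ ^ m₁ * T₂ ^ m₂ * T₃ ^ n) h

/-- The minimality condition for the dilation: `K` is the closed linear span of the vectors
`Q₁^{m₁} Q₂^{m₂} Vⁿ h` with `h ∈ H`. -/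
def IsMinimalDilation (W : H →ₗᵢ[ℂ] K) (Q₁ Q₂ V : K →L[ℂ] K) : Prop :=
  (Submodule.span ℂ {k | ∃ (m₁ m₂ n : ℕ) (h : H),
    k = (Q₁ ^ m₁ * Q₂ ^ m₂ * V ^ n) (W h)}).topologicalClosure = ⊤

end Classes

/-! ### The Hardy space of the unit disc -/

/-- The sequence space `ℓ²`. -/
abbrev EllTwo : Type := lp (fun _ : ℕ => ℂ) 2

lemma summable_powerSeries (a : EllTwo) (z : Complex.UnitDisc) :
    Summable fun n => a n * (z : ℂ) ^ n := by
  have hz : ‖(z : ℂ)‖ < 1 := z.norm_lt_one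
  refine Summable.of_norm_bounded (g := fun n => ‖a‖ * ‖(z : ℂ)‖ ^ n)
    ((summable_geometric_of_lt_one (norm_nonneg _) hz).mul_left _) fun n => ?_
  rw [norm_mul, norm_pow]
  gcongr
  exact lp.norm_apply_le_norm (by norm_num) a n

/-- The function `z ↦ ∑ aₙ zⁿ` on the unit disc. -/
noncomputable def powerSeriesMap : EllTwo →ₗ[ℂ] (Complex.UnitDisc → ℂ) where
  toFun a z := ∑' n, a n * (z : ℂ) ^ n
  map_add' a b := by
    ext z
    simp only [lp.coeFn_add, Pi.add_apply, add_mul]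
    exact (summable_powerSeries a z).tsum_add (summable_powerSeries b z)
  map_smul' c a := by
    ext z
    simp only [lp.coeFn_smul, Pi.smul_apply, smul_eq_mul, mul_assoc, RingHom.id_apply]
    exact (summable_powerSeries a z).tsum_mul_left c

lemma powerSeriesMap_injective : Function.Injective powerSeriesMap := by
  rw [← LinearMap.ker_eq_bot, LinearMap.ker_eq_bot']
  intro a ha
  have key : HasFPowerSeriesOnBall (fun _ : ℂ => (0 : ℂ))
      (FormalMultilinearSeries.ofScalars ℂ (fun n => a n)) 0 1 := by
    refine ⟨?_, one_pos, ?_⟩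
    · refine ENNReal.le_of_forall_nnreal_lt fun r hr => ?_
      refine FormalMultilinearSeries.le_radius_of_bound _ ‖a‖ fun n => ?_
      have hr' : (r : ℝ) ≤ 1 := by exact_mod_cast hr.le
      calc _ ≤ ‖a n‖ * 1 := by
            rw [FormalMultilinearSeries.ofScalars_norm]
            gcongr
            exact pow_le_one₀ r.2 hr'
        _ ≤ ‖a‖ := by rw [mul_one]; exact lp.norm_apply_le_norm (by norm_num) a n
    · intro y hy
      have hy' : ‖y‖ < 1 := by
        simpa [Metric.mem_eball, edist_zero_right, ← ofReal_norm] using hy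
      have h1 := (summable_powerSeries a (Complex.UnitDisc.mk y hy')).hasSum
      have h2 := congrFun ha (Complex.UnitDisc.mk y hy')
      change ∑' n, a n * y ^ n = 0 at h2
      change HasSum (fun n => a n * y ^ n) (∑' n, a n * y ^ n) at h1
      rw [h2] at h1
      simpa [FormalMultilinearSeries.ofScalars_apply_eq, mul_comm] using h1
  have h0 := key.hasFPowerSeriesAt.eq_zero
  ext n
  have := congrArg (fun p => FormalMultilinearSeries.coeff p n) h0
  rw [FormalMultilinearSeries.coeff_ofScalars] at this
  simpa [FormalMultilinearSeries.coeff] using this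

/-- The functions `f : 𝔻 → ℂ` of the form `f(z) = ∑ aₙ zⁿ` with `∑ |aₙ|² < ∞`. -/
noncomputable def hardySubmodule : Submodule ℂ (Complex.UnitDisc → ℂ) :=
  LinearMap.range powerSeriesMap

/-- The Hardy space `H²(𝔻)` of all holomorphic functions `f(z) = ∑ aₙ zⁿ` on the unit disc with
`∑ |aₙ|² < ∞`. Its inner product, given below, is `⟪∑ aₙ zⁿ, ∑ bₙ zⁿ⟫ = ∑ conj(aₙ) bₙ`. -/
def HardySpace : Type := hardySubmodule

namespace HardySpace

noncomputable instance : AddCommGroup HardySpace := inferInstanceAs (AddCommGroup hardySubmodule)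

noncomputable instance : Module ℂ HardySpace := inferInstanceAs (Module ℂ hardySubmodule)

instance : CoeFun HardySpace fun _ => Complex.UnitDisc → ℂ := ⟨Subtype.val⟩

/-- The sequence of Taylor coefficients at `0`. -/
noncomputable def coeffs : HardySpace ≃ₗ[ℂ] EllTwo :=
  (LinearEquiv.ofInjective powerSeriesMap powerSeriesMap_injective).symm

noncomputable instance : NormedAddCommGroup HardySpace :=
  NormedAddCommGroup.induced HardySpace EllTwo coeffs coeffs.injective

noncomputable instance : InnerProductSpace ℂ HardySpace :=
  { NormedSpace.induced ℂ HardySpace EllTwo coeffs with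
    inner := fun f g => inner ℂ (coeffs f) (coeffs g)
    norm_sq_eq_re_inner := fun f => norm_sq_eq_re_inner (𝕜 := ℂ) (coeffs f)
    conj_inner_symm := fun f g => inner_conj_symm (coeffs f) (coeffs g)
    add_left := fun f g h => by rw [map_add, inner_add_left]
    smul_left := fun f g c => by rw [map_smul, inner_smul_left] }

lemma norm_coeffs (f : HardySpace) : ‖coeffs f‖ = ‖f‖ := rfl

lemma inner_coeffs (f g : HardySpace) : inner ℂ (coeffs f) (coeffs g) = inner ℂ f g := rfl

lemma hasSum_coeffs (f : HardySpace) (z : Complex.UnitDisc) :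
    HasSum (fun n => coeffs f n * (z : ℂ) ^ n) (f z) := by
  have h : powerSeriesMap (coeffs f) = f.1 :=
    congrArg Subtype.val
      ((LinearEquiv.ofInjective powerSeriesMap powerSeriesMap_injective).apply_symm_apply f)
  rw [← h]
  exact (summable_powerSeries (coeffs f) z).hasSum

lemma coeffs_eq {f : HardySpace} {a : EllTwo}
    (h : ∀ z : Complex.UnitDisc, HasSum (fun n => a n * (z : ℂ) ^ n) (f z)) : coeffs f = a := by
  refine powerSeriesMap_injective (funext fun z => ?_)
  exact (hasSum_coeffs f z).tsum_eq.trans (h z).tsum_eq.symm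

/-- `coeffs` as a unitary operator. -/
noncomputable def coeffsIsometry : HardySpace ≃ₗᵢ[ℂ] EllTwo := ⟨coeffs, norm_coeffs⟩

instance : CompleteSpace HardySpace :=
  (completeSpace_congr (e := coeffs.toEquiv) coeffsIsometry.isometry.isUniformEmbedding).2
    inferInstance

/-- The forward shift of a square summable sequence. -/
noncomputable def shiftSeq (a : EllTwo) : EllTwo :=
  ⟨fun n => Nat.casesOn n 0 fun k => a k, by
    refine memℓp_gen ((summable_nat_add_iff 1).1 ?_)
    simpa using (lp.memℓp a).summable (by norm_num)⟩

lemma norm_shiftSeq (a : EllTwo) : ‖shiftSeq a‖ = ‖a‖ := by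
  have h2 : (0 : ℝ) < (2 : ℝ≥0∞).toReal := by norm_num
  rw [lp.norm_eq_tsum_rpow h2, lp.norm_eq_tsum_rpow h2,
    ((lp.memℓp (shiftSeq a)).summable h2).tsum_eq_zero_add]
  simp [shiftSeq]

lemma hasSum_shiftSeq (f : HardySpace) (z : Complex.UnitDisc) :
    HasSum (fun n => shiftSeq (coeffs f) n * (z : ℂ) ^ n) ((z : ℂ) * f z) := by
  rw [← hasSum_nat_add_iff' 1]
  simpa [shiftSeq, pow_succ, mul_assoc, mul_comm, mul_left_comm] using
    (hasSum_coeffs f z).mul_left (z : ℂ)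

/-- The operator `M_z` of multiplication by the coordinate function on `H²(𝔻)`. -/
noncomputable def Mz : HardySpace →L[ℂ] HardySpace :=
  LinearMap.mkContinuous
    { toFun := fun f => ⟨fun z => (z : ℂ) * f z,
        ⟨shiftSeq (coeffs f), funext fun z => (hasSum_shiftSeq f z).tsum_eq⟩⟩
      map_add' := fun f g => Subtype.ext (funext fun z => mul_add (z : ℂ) (f z) (g z))
      map_smul' := fun c f => Subtype.ext (funext fun z => mul_left_comm (z : ℂ) c (f z)) }
    1 fun f => by
      rw [one_mul, ← norm_coeffs, coeffs_eq (a := shiftSeq (coeffs f)), norm_shiftSeq, norm_coeffs]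
      exact fun z => hasSum_shiftSeq f z

lemma Mz_apply (f : HardySpace) (z : Complex.UnitDisc) : (Mz f) z = (z : ℂ) * f z := rfl

end HardySpace

/-! ### Hilbert space tensor products -/

section Tensor

variable (E F : Type*) [NormedAddCommGroup E] [InnerProductSpace ℂ E]
  [NormedAddCommGroup F] [InnerProductSpace ℂ F]

/-- The Hilbert space tensor product: the completion of the algebraic tensor product in the norm
of the inner product `⟪x ⊗ y, x' ⊗ y'⟫ = ⟪x, x'⟫ ⟪y, y'⟫`. -/
abbrev HilbertTensor : Type _ := UniformSpace.Completion (E ⊗[ℂ] F)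

variable {E F}

/-- The bounded operator `A ⊗ B` on the Hilbert space tensor product. -/
noncomputable def opTensor (A : E →L[ℂ] E) (B : F →L[ℂ] F) :
    HilbertTensor E F →L[ℂ] HilbertTensor E F :=
  (TensorProduct.mapL A B).completion

end Tensor

end Tetrablock

open Tetrablock

/-! The argument has two independent halves: that `(Q₁, Q₂, V)` is a pure `𝔼`-isometry, and that it
dilates `(T₁, T₂, T)`. Write `A₁, A₂` for the fundamental operators of the adjoint triple and `D`
for the defect map of `T*`.

For the first half, replace `M_z` by the bilateral shift `U` on `ℓ²(ℤ)`. The hypotheses on `A₁, A₂`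
say exactly that the coefficients of the two pencils `A₁* + U A₂` and `A₂* + U A₁` match up to give
a commuting triple with `U ⊗ I`. Since `U` is unitary, `N₁ = N₂* N₃`, which makes `N₁` and `N₂`
normal and puts the first two conditions of `b𝔼` on the joint spectrum
(`isEUnitary_of_eq_adjoint_mul`). There remains `|x₂| ≤ 1`, for which the numerical radius of `A₂* +
U A₁` must be at most one. For `|w| ≤ 1` the functions `(x₁ - w x₃)/(1 - w x₂)` and `(x₂ - w x₃)/(1
- w x₁)` are bounded by one where defined on the closed tetrablock. The von Neumann inequality turns
this into norm estimates for the adjoints; squared and added, they give `Re (z⟪ξ, A₁ξ⟫ + w⟪ξ, A₂ξ⟫)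
≤ ‖ξ‖²` for unimodular `z, w` (`IsEContraction.re_inner_fundamentalOperators_le`). An averaging
argument (`re_inner_add_mul_le`) passes from scalars to `U`. Restriction to `H² ⊗ 𝒟_{T*}` gives the
`𝔼`-isometry.

For the second half, `W h = ∑ zⁿ ⊗ D T*ⁿ h` is isometric because `T` is pure. The identity `D T₁* =
A₁ D + A₂* D T*` and its mirror image give `W* Q₁ = T₁ W*`, `W* Q₂ = T₂ W*`, besides `W* V = T W*`;
hence `W*` intertwines all monomials and `W* W = I` yields the dilation. Minimality needs only `V`,
since `W h - V W T* h = 1 ⊗ D h`. -/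

namespace Tetrablock

/-! ### Operators on Hilbert space tensor products -/

section OpTensor

variable {E F E' F' : Type*} [NormedAddCommGroup E] [InnerProductSpace ℂ E]
  [NormedAddCommGroup F] [InnerProductSpace ℂ F]
  [NormedAddCommGroup E'] [InnerProductSpace ℂ E']
  [NormedAddCommGroup F'] [InnerProductSpace ℂ F']

/-- The elementary tensor `x ⊗ y`, as a continuous bilinear map into the Hilbert space tensor
product. -/
noncomputable def elemTensor : E →L[ℂ] F →L[ℂ] HilbertTensor E F :=
  (ContinuousLinearMap.compL ℂ F (E ⊗[ℂ] F) (HilbertTensor E F)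
    UniformSpace.Completion.toComplL) ∘L TensorProduct.mkL ℂ E F

lemma elemTensor_apply (x : E) (y : F) :
    elemTensor x y = ((x ⊗ₜ[ℂ] y : E ⊗[ℂ] F) : HilbertTensor E F) := rfl

lemma inner_elemTensor (x x' : E) (y y' : F) :
    inner ℂ (elemTensor x y) (elemTensor x' y') = inner ℂ x x' * inner ℂ y y' := by
  rw [elemTensor_apply, elemTensor_apply, UniformSpace.Completion.inner_coe,
    TensorProduct.inner_tmul]

/-- A closed subspace that contains all elementary tensors is everything. -/
lemma eq_top_of_elemTensor_mem {S : Submodule ℂ (HilbertTensor E F)}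
    (hS : IsClosed (S : Set (HilbertTensor E F))) (h : ∀ x y, elemTensor x y ∈ S) : S = ⊤ := by
  rw [eq_top_iff]
  rintro t -
  induction t using UniformSpace.Completion.induction_on with
  | hp => exact hS
  | ih t =>
    induction t using TensorProduct.induction_on with
    | zero => rw [UniformSpace.Completion.coe_zero]; exact S.zero_mem
    | tmul x y => exact h x y
    | add a b ha hb => rw [UniformSpace.Completion.coe_add]; exact S.add_mem ha hb

lemma ext_elemTensor {X : Type*} [NormedAddCommGroup X] [NormedSpace ℂ X]
    {f g : HilbertTensor E F →L[ℂ] X} (h : ∀ x y, f (elemTensor x y) = g (elemTensor x y)) :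
    f = g := by
  have : LinearMap.eqLocus f.toLinearMap g.toLinearMap = ⊤ :=
    eq_top_of_elemTensor_mem (isClosed_eq f.continuous g.continuous) h
  ext t
  exact (this ▸ Submodule.mem_top : t ∈ LinearMap.eqLocus f.toLinearMap g.toLinearMap)

@[simp] lemma opTensor_elemTensor (A : E →L[ℂ] E) (B : F →L[ℂ] F) (x : E) (y : F) :
    opTensor A B (elemTensor x y) = elemTensor (A x) (B y) := by
  rw [elemTensor_apply, opTensor, ContinuousLinearMap.completion_apply_coe]; rfl

lemma opTensor_one : opTensor (1 : E →L[ℂ] E) (1 : F →L[ℂ] F) = 1 :=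
  ext_elemTensor fun x y => by simp

lemma opTensor_mul (A A' : E →L[ℂ] E) (B B' : F →L[ℂ] F) :
    opTensor A B * opTensor A' B' = opTensor (A * A') (B * B') :=
  ext_elemTensor fun x y => by simp

lemma opTensor_add_right (A : E →L[ℂ] E) (B B' : F →L[ℂ] F) :
    opTensor A (B + B') = opTensor A B + opTensor A B' :=
  ext_elemTensor fun x y => by simp

lemma opTensor_smul_right (A : E →L[ℂ] E) (c : ℂ) (B : F →L[ℂ] F) :
    opTensor A (c • B) = c • opTensor A B :=
  ext_elemTensor fun x y => by simp

lemma adjoint_opTensor [CompleteSpace E] [CompleteSpace F] (A : E →L[ℂ] E) (B : F →L[ℂ] F) :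
    (opTensor A B)† = opTensor (A†) (B†) := by
  refine ext_elemTensor fun x y => ?_
  refine ext_inner_left ℂ fun v => ?_
  rw [ContinuousLinearMap.adjoint_inner_right]
  have : (innerSL ℂ (opTensor (A†) (B†) (elemTensor x y))) =
      (innerSL ℂ (elemTensor x y)) ∘L opTensor A B := by
    refine ext_elemTensor fun x' y' => ?_
    simp [inner_elemTensor, ContinuousLinearMap.adjoint_inner_left]
  have := congrArg (fun f => conj (f v)) this
  simpa using this.symm

/-- The isometry `j ⊗ k` between Hilbert space tensor products. -/
noncomputable def isometryTensor (j : E →ₗᵢ[ℂ] E') (k : F →ₗᵢ[ℂ] F') :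
    HilbertTensor E F →ₗᵢ[ℂ] HilbertTensor E' F' where
  toLinearMap := ((TensorProduct.mapIsometry j k).toContinuousLinearMap.completion).toLinearMap
  norm_map' t := by
    induction t using UniformSpace.Completion.induction_on with
    | hp => exact isClosed_eq (ContinuousLinearMap.continuous _).norm continuous_norm
    | ih t =>
      change ‖(TensorProduct.mapIsometry j k).toContinuousLinearMap.completion t‖ = _
      rw [ContinuousLinearMap.completion_apply_coe, UniformSpace.Completion.norm_coe,
        UniformSpace.Completion.norm_coe]
      exact (TensorProduct.mapIsometry j k).norm_map t

@[simp] lemma isometryTensor_elemTensor (j : E →ₗᵢ[ℂ] E') (k : F →ₗᵢ[ℂ] F') (x : E) (y : F) :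
    isometryTensor j k (elemTensor x y) = elemTensor (j x) (k y) := by
  change (TensorProduct.mapIsometry j k).toContinuousLinearMap.completion _ = _
  rw [elemTensor_apply, ContinuousLinearMap.completion_apply_coe]; rfl

lemma isometryTensor_opTensor {j : E →ₗᵢ[ℂ] E'} {k : F →ₗᵢ[ℂ] F'} {A : E →L[ℂ] E}
    {A' : E' →L[ℂ] E'} {B : F →L[ℂ] F} {B' : F' →L[ℂ] F'} (hA : ∀ x, A' (j x) = j (A x))
    (hB : ∀ y, B' (k y) = k (B y)) (t : HilbertTensor E F) :
    opTensor A' B' (isometryTensor j k t) = isometryTensor j k (opTensor A B t) := by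
  have : opTensor A' B' ∘L (isometryTensor j k).toContinuousLinearMap =
      (isometryTensor j k).toContinuousLinearMap ∘L opTensor A B :=
    ext_elemTensor fun x y => by simp [hA, hB]
  exact DFunLike.congr_fun this t

end OpTensor

/-! ### Numerical range estimates and invertibility -/

section NumericalRange

variable {E F K : Type*} [NormedAddCommGroup E] [InnerProductSpace ℂ E] [CompleteSpace E]
  [NormedAddCommGroup F] [InnerProductSpace ℂ F] [CompleteSpace F]
  [NormedAddCommGroup K] [InnerProductSpace ℂ K]

lemma re_inner_opTensor_one_nonneg {P : F →L[ℂ] F} (hP : 0 ≤ P) (f : HilbertTensor E F) :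
    0 ≤ (inner ℂ (opTensor (1 : E →L[ℂ] E) P f) f).re := by
  have hS : (CFC.sqrt P)† * CFC.sqrt P = P := by
    have h1 : IsSelfAdjoint (CFC.sqrt P) := (CFC.sqrt_nonneg P).isSelfAdjoint
    rw [← ContinuousLinearMap.star_eq_adjoint, h1.star_eq, CFC.sqrt_mul_sqrt_self P hP]
  have h2 : opTensor (1 : E →L[ℂ] E) P =
      (opTensor (1 : E →L[ℂ] E) (CFC.sqrt P))† * opTensor 1 (CFC.sqrt P) := by
    rw [adjoint_opTensor, opTensor_mul, hS, ← ContinuousLinearMap.star_eq_adjoint, star_one,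
      one_mul]
  rw [h2, mul_apply_eq_comp, ContinuousLinearMap.adjoint_inner_left]
  exact inner_self_nonneg (𝕜 := ℂ)

/-- A bound of the real part of the numerical range of `B` is inherited by `I ⊗ B`. -/
lemma re_inner_opTensor_one_le {B : F →L[ℂ] F} (hB : ∀ y, (inner ℂ (B y) y).re ≤ ‖y‖ ^ 2)
    (f : HilbertTensor E F) :
    (inner ℂ (opTensor (1 : E →L[ℂ] E) B f) f).re ≤ ‖f‖ ^ 2 := by
  -- The hypothesis on `B` says that `2 - (B + B*)` is positive, and positivity survives tensoring
  -- with the identity.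
  have hP : 0 ≤ (2 : ℂ) • (1 : F →L[ℂ] F) + (-1 : ℂ) • (B + B†) := by
    rw [ContinuousLinearMap.nonneg_iff_isPositive, ContinuousLinearMap.isPositive_def']
    constructor
    · rw [IsSelfAdjoint, star_add, star_smul, star_smul, star_add, star_one,
        ContinuousLinearMap.star_eq_adjoint, ContinuousLinearMap.star_eq_adjoint,
        ContinuousLinearMap.adjoint_adjoint, add_comm B]
      simp
    · intro y
      have := hB y
      have h2 : (inner ℂ ((B†) y) y).re = (inner ℂ (B y) y).re := by
        rw [ContinuousLinearMap.adjoint_inner_left, ← inner_conj_symm, Complex.conj_re]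
      simp only [ContinuousLinearMap.reApplyInnerSelf, add_apply,
        smul_apply, one_apply_eq_self, inner_add_left,
        inner_smul_left, RCLike.re_to_complex, Complex.add_re, inner_self_eq_norm_sq_to_K]
      simp [h2, ← Complex.ofReal_pow]
      linarith
  have h := re_inner_opTensor_one_nonneg (E := E) hP f
  have h2 : (inner ℂ (opTensor (1 : E →L[ℂ] E) (B†) f) f).re =
      (inner ℂ (opTensor (1 : E →L[ℂ] E) B f) f).re := by
    have : opTensor (1 : E →L[ℂ] E) (B†) = (opTensor (1 : E →L[ℂ] E) B)† := by
      rw [adjoint_opTensor, ← ContinuousLinearMap.star_eq_adjoint 1, star_one]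
    rw [this, ContinuousLinearMap.adjoint_inner_left, ← inner_conj_symm, Complex.conj_re]
  rw [opTensor_add_right, opTensor_smul_right, opTensor_smul_right, opTensor_add_right,
    opTensor_one] at h
  simp only [add_apply,
        smul_apply, one_apply_eq_self, inner_add_left,
        inner_smul_left, Complex.add_re, inner_self_eq_norm_sq_to_K] at h
  simp [h2, ← Complex.ofReal_pow] at h
  linarith

lemma sum_rootOfUnity_zpow {N : ℕ} {ω : ℂ} (hω : IsPrimitiveRoot ω N) {m : ℤ}
    (hm : |m| < N) :
    ∑ j ∈ Finset.range N, (ω ^ j) ^ m = if m = 0 then (N : ℂ) else 0 := by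
  split_ifs with h
  · simp [h]
  · have h1 : ω ^ m ≠ 1 := fun h1 => by
      have := Int.eq_zero_of_abs_lt_dvd ((hω.zpow_eq_one_iff_dvd m).1 h1) hm
      exact h this
    have h2 : ∀ j : ℕ, (ω ^ j) ^ m = (ω ^ m) ^ j := fun j => by
      rw [← zpow_natCast, ← zpow_natCast, zpow_comm]
    simp_rw [h2]
    rw [geom_sum_eq h1, ← h2, hω.pow_eq_one]
    simp

/-- If `M` is an isometry that commutes with `B` and `C`, then the bound `Re (B + ζ C) ≤ 1` for
all unimodular numbers `ζ` gives `Re (B + M C) ≤ 1`. -/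
lemma re_inner_add_mul_le {M B C : K →L[ℂ] K} (hM : ∀ x y, inner ℂ (M x) (M y) = inner ℂ x y)
    (hB : Commute M B) (hC : Commute M C)
    (h : ∀ ζ : ℂ, ‖ζ‖ = 1 → ∀ g, (inner ℂ ((B + ζ • C) g) g).re ≤ ‖g‖ ^ 2) (f : K) :
    (inner ℂ ((B + M * C) f) f).re ≤ ‖f‖ ^ 2 := by
  have hMk : ∀ (k : ℕ) x y, inner ℂ ((M ^ k) x) ((M ^ k) y) = inner ℂ x y := by
    intro k
    induction k with
    | zero => simp
    | succ k ih => intro x y; rw [pow_succ, mul_apply_eq_comp,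
        mul_apply_eq_comp, ih, hM]
  set a := ‖f‖ ^ 2
  set b := (inner ℂ (B f) f).re
  set c := (inner ℂ (M (C f)) f).re
  have hBk : ∀ k : ℕ, (inner ℂ (B ((M ^ k) f)) ((M ^ k) f)).re = b := fun k => by
    rw [← mul_apply_eq_comp B, ← (hB.pow_left k).eq, mul_apply_eq_comp,
      hMk]
  have hCk : ∀ k : ℕ, (inner ℂ (C ((M ^ (k + 1)) f)) ((M ^ k) f)).re = c := fun k => by
    rw [← mul_apply_eq_comp C, ← (hC.pow_left (k + 1)).eq,
      pow_succ, mul_apply_eq_comp, mul_apply_eq_comp, hMk]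
  have key : ∀ n : ℕ, (n + 1 : ℝ) * b + n * c ≤ (n + 1) * a := by
    intro n
    -- The exponents `k - l - s` below, with `k, l ≤ n` and `s ≤ 1`, have modulus at most `n + 1`,
    -- so `N = n + 2` roots of unity separate them from zero.
    set N := n + 2 with hN
    have hω := Complex.isPrimitiveRoot_exp N (by omega)
    set ω := Complex.exp (2 * Real.pi * Complex.I / N)
    have hω1 : ∀ j : ℕ, ‖ω ^ j‖ = 1 := fun j => by
      rw [norm_pow, hω.norm'_eq_one (by omega), one_pow]
    have hω0 : ∀ j : ℕ, ω ^ j ≠ 0 := fun j h0 => by simpa [h0] using hω1 j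
    -- The test vectors are truncated approximate eigenvectors: up to boundary terms `M` acts on `g
    -- j` as multiplication by `ω ^ j`.
    set g : ℕ → K := fun j => ∑ k ∈ Finset.range (n + 1), ((ω ^ j)⁻¹ ^ k) • (M ^ k) f
    have hconj : ∀ j : ℕ, conj ω ^ j = (ω ^ j)⁻¹ := fun j => by
      rw [← map_pow, Complex.inv_eq_conj (hω1 j)]
    -- Summing over the roots of unity keeps only the terms with `k = l + s`: the diagonal for `B`,
    -- the first subdiagonal for `C`.
    have expand : ∀ (X : K →L[ℂ] K) (s : ℕ), s ≤ 1 →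
        ∑ j ∈ Finset.range N, inner ℂ (((ω ^ j) ^ s) • X (g j)) (g j) =
          N * ∑ k ∈ Finset.range (n + 1), ∑ l ∈ Finset.range (n + 1),
            if k = l + s then inner ℂ (X ((M ^ k) f)) ((M ^ l) f) else 0 := by
      intro X s hs
      have h1 : ∀ j, inner ℂ (((ω ^ j) ^ s) • X (g j)) (g j) =
          ∑ k ∈ Finset.range (n + 1), ∑ l ∈ Finset.range (n + 1),
            (ω ^ j) ^ ((k : ℤ) - l - s) * inner ℂ (X ((M ^ k) f)) ((M ^ l) f) := by
        intro j
        simp only [g, map_sum, map_smul, Finset.smul_sum, sum_inner]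
        refine Finset.sum_congr rfl fun k _ => ?_
        rw [inner_sum]
        refine Finset.sum_congr rfl fun l _ => ?_
        rw [inner_smul_left, inner_smul_left, inner_smul_right, ← mul_assoc, ← mul_assoc]
        congr 1
        rw [zpow_sub₀ (hω0 j), zpow_sub₀ (hω0 j)]
        simp only [map_pow, map_inv₀, hconj, inv_inv, zpow_natCast, inv_pow]
        field_simp
      simp_rw [h1]
      rw [Finset.sum_comm, Finset.mul_sum]
      refine Finset.sum_congr rfl fun k hk => ?_
      rw [Finset.sum_comm, Finset.mul_sum]
      refine Finset.sum_congr rfl fun l hl => ?_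
      rw [Finset.mem_range] at hk hl
      rw [← Finset.sum_mul, sum_rootOfUnity_zpow hω (by rw [abs_lt]; omega)]
      by_cases hkl : k = l + s
      · rw [if_pos hkl, if_pos (by omega)]
      · rw [if_neg hkl, if_neg (by omega)]; simp
    have hsum : ∑ j ∈ Finset.range N, (inner ℂ ((B + ω ^ j • C) (g j)) (g j)).re ≤
        ∑ j ∈ Finset.range N, (inner ℂ (g j) (g j)).re := by
      refine Finset.sum_le_sum fun j _ => (h _ (hω1 j) (g j)).trans_eq ?_
      rw [inner_self_eq_norm_sq_to_K]; simp [← Complex.ofReal_pow]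
    have e0 := congrArg Complex.re (expand 1 0 (by omega))
    have e1 := congrArg Complex.re (expand B 0 (by omega))
    have e2 := congrArg Complex.re (expand C 1 le_rfl)
    have d0 : ∀ X : K →L[ℂ] K, ∑ k ∈ Finset.range (n + 1), ∑ l ∈ Finset.range (n + 1),
        (if k = l + 0 then inner ℂ (X ((M ^ k) f)) ((M ^ l) f) else 0) =
        ∑ k ∈ Finset.range (n + 1), inner ℂ (X ((M ^ k) f)) ((M ^ k) f) := by
      intro X
      refine Finset.sum_congr rfl fun k hk => ?_
      simp only [add_zero, Finset.sum_ite_eq, hk, if_true]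
    have d1 : ∑ k ∈ Finset.range (n + 1), ∑ l ∈ Finset.range (n + 1),
        (if k = l + 1 then inner ℂ (C ((M ^ k) f)) ((M ^ l) f) else 0) =
        ∑ l ∈ Finset.range n, inner ℂ (C ((M ^ (l + 1)) f)) ((M ^ l) f) := by
      rw [Finset.sum_comm, Finset.sum_range_succ, Finset.sum_eq_zero
        (s := Finset.range (n + 1)) (f := fun k => if k = n + 1 then _ else _), add_zero]
      · refine Finset.sum_congr rfl fun l hl => ?_
        rw [Finset.sum_ite_eq', if_pos]
        rw [Finset.mem_range] at hl ⊢; omega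
      · intro k hk
        rw [Finset.mem_range] at hk
        rw [if_neg (by omega)]
    rw [d0] at e0 e1
    rw [d1] at e2
    have re_N : ∀ z : ℂ, ((N : ℂ) * z).re = N * z.re := fun z => by simp
    simp only [pow_zero, one_smul, pow_one, re_N, Complex.re_sum,
      one_apply_eq_self, hBk, hCk, hMk, Finset.sum_const, Finset.card_range,
      nsmul_eq_mul] at e0 e1 e2
    simp only [add_apply, smul_apply, inner_add_left,
      Complex.add_re, Finset.sum_add_distrib] at hsum
    rw [e0, e1, e2, ← mul_add] at hsum
    have hNpos : (0 : ℝ) < N := by rw [hN]; positivity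
    have := le_of_mul_le_mul_left hsum hNpos
    simpa [a, ← Complex.ofReal_pow] using this
  -- The subdiagonal has only `n` entries against `n + 1` on the diagonal, a defect that disappears
  -- for large `n`.
  have hgoal : b + c ≤ a := by
    by_contra! hlt
    obtain ⟨n, hn⟩ := exists_nat_gt ((a - b) / (b + c - a))
    rw [div_lt_iff₀ (by linarith)] at hn
    have := key n
    nlinarith
  simpa [inner_add_left, b, c] using hgoal

/-- An operator whose real part is bounded below by a positive constant is invertible. -/
lemma isUnit_of_re_inner_ge [CompleteSpace K] {X : K →L[ℂ] K} {c : ℝ} (hc : 0 < c)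
    (h : ∀ f, c * ‖f‖ ^ 2 ≤ (inner ℂ (X f) f).re) : IsUnit X := by
  -- `‖(1 - tX)f‖² ≤ (1 - 2tc + t²‖X‖²)‖f‖²`, and this `t` makes `t²‖X‖² ≤ tc`. The summand `c²`
  -- keeps the denominator positive and `tc ≤ 1`. Thus `tX` is within distance less than one of the
  -- identity.
  set t : ℝ := c / (‖X‖ ^ 2 + c ^ 2)
  have hD : 0 < ‖X‖ ^ 2 + c ^ 2 := by positivity
  have ht : 0 < t := div_pos hc hD
  have htD : t * (‖X‖ ^ 2 + c ^ 2) = c := div_mul_cancel₀ _ hD.ne'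
  have htc : t * c ≤ 1 := by
    rw [div_mul_eq_mul_div, div_le_one hD]; nlinarith [sq_nonneg ‖X‖]
  have hbound : ‖1 - (t : ℂ) • X‖ ≤ Real.sqrt (1 - t * c) := by
    refine ContinuousLinearMap.opNorm_le_bound _ (Real.sqrt_nonneg _) fun f => ?_
    refine abs_le_of_sq_le_sq' ?_ (by positivity) |>.2
    rw [mul_pow, Real.sq_sqrt (by linarith)]
    have h1 : ‖(1 - (t : ℂ) • X) f‖ ^ 2 =
        ‖f‖ ^ 2 - 2 * (t * (inner ℂ (X f) f).re) + t ^ 2 * ‖X f‖ ^ 2 := by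
      have := norm_sub_sq (𝕜 := ℂ) f ((t : ℂ) • X f)
      rw [sub_apply, smul_apply,
        one_apply_eq_self, this, inner_smul_right, norm_smul, mul_pow]
      have hsymm : (inner ℂ f (X f)).re = (inner ℂ (X f) f).re := inner_re_symm (𝕜 := ℂ) _ _
      simp [hsymm]
    have h2 : ‖X f‖ ^ 2 ≤ ‖X‖ ^ 2 * ‖f‖ ^ 2 := by
      rw [← mul_pow]; gcongr; exact X.le_opNorm f
    have h3 := h f
    rw [h1]
    have h4 : t ^ 2 * ‖X f‖ ^ 2 ≤ t * c * ‖f‖ ^ 2 := by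
      calc t ^ 2 * ‖X f‖ ^ 2 ≤ t ^ 2 * ((‖X‖ ^ 2 + c ^ 2) * ‖f‖ ^ 2) := by
            gcongr; nlinarith [mul_nonneg (sq_nonneg c) (sq_nonneg ‖f‖)]
        _ = t * (t * (‖X‖ ^ 2 + c ^ 2)) * ‖f‖ ^ 2 := by ring
        _ = _ := by rw [htD]
    nlinarith [mul_le_mul_of_nonneg_left h3 ht.le]
  have hlt : ‖1 - (t : ℂ) • X‖ < 1 := hbound.trans_lt (by
    rw [Real.sqrt_lt' one_pos]; nlinarith [mul_pos ht hc])
  have hu := isUnit_one_sub_of_norm_lt_one hlt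
  rw [sub_sub_cancel] at hu
  have ht0 : (t : ℂ) ≠ 0 := by exact_mod_cast ht.ne'
  exact (isUnit_smul_iff (Units.mk0 _ ht0) X).1 hu

/-- The spectrum of an operator of numerical radius at most one is in the closed disc. -/
lemma isUnit_sub_of_numericalRadius_le [CompleteSpace K] {N : K →L[ℂ] K}
    (h : ∀ β : ℂ, ‖β‖ = 1 → ∀ f, (inner ℂ ((β • N) f) f).re ≤ ‖f‖ ^ 2) {l : ℂ} (hl : 1 < ‖l‖) :
    IsUnit (N - l • 1) := by
  have hl0 : l ≠ 0 := fun h0 => by simp [h0] at hl; linarith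
  have hn0 : (‖l‖ : ℂ) ≠ 0 := by simpa using hl0
  -- This rotation moves `l` to the positive axis, so that `-β(N - l) = |l| - βN` has real part at
  -- least `|l| - 1`.
  set β : ℂ := conj l / ‖l‖
  have hβ : ‖β‖ = 1 := by simp [β, hl0]
  have hβl : β * l = ‖l‖ := by
    simp only [β]
    rw [div_mul_eq_mul_div, Complex.conj_mul', sq, mul_div_assoc, div_self hn0, mul_one]
  have hβ0 : -β ≠ 0 := fun h0 => by rw [neg_eq_zero] at h0; simp [h0] at hβ
  refine (isUnit_smul_iff (Units.mk0 _ hβ0) _).1 (isUnit_of_re_inner_ge (c := ‖l‖ - 1) (by linarith) fun f => ?_)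
  rw [Units.smul_mk0]
  have h1 : (-β) • (N - l • 1) = (‖l‖ : ℂ) • 1 - β • N := by
    rw [smul_sub, smul_smul, neg_mul, hβl, neg_smul, neg_smul]; abel
  rw [h1, sub_apply, inner_sub_left, Complex.sub_re,
    smul_apply, one_apply_eq_self, inner_smul_left,
    inner_self_eq_norm_sq_to_K]
  have := h β hβ f
  rw [smul_apply] at this
  simp [← Complex.ofReal_pow]
  linarith

end NumericalRange

/-! ### Taylor regularity and a criterion for `𝔼`-unitaries -/

section TaylorSpectrum

/-- Contraction with `(B₁, B₂, B₃)` is a homotopy from the identity of the Koszul complex to zero;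
the witnesses in the proof are its components. -/
lemma isTaylorRegular_of_sum_mul_eq_one {X : Type*} [NormedAddCommGroup X] [NormedSpace ℂ X]
    {S₁ S₂ S₃ B₁ B₂ B₃ : X →L[ℂ] X} (h₁₂ : Commute S₁ S₂) (h₁₃ : Commute S₁ S₃)
    (h₂₃ : Commute S₂ S₃) (hB₁ : Commute B₁ S₁ ∧ Commute B₁ S₂ ∧ Commute B₁ S₃)
    (hB₂ : Commute B₂ S₁ ∧ Commute B₂ S₂ ∧ Commute B₂ S₃)
    (hB₃ : Commute B₃ S₁ ∧ Commute B₃ S₂ ∧ Commute B₃ S₃)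
    (hsum : B₁ * S₁ + B₂ * S₂ + B₃ * S₃ = 1) : IsTaylorRegular S₁ S₂ S₃ := by
  have ap : ∀ {A B : X →L[ℂ] X}, Commute A B → ∀ x, A (B x) = B (A x) := fun h x =>
    DFunLike.congr_fun h.eq x
  have hs : ∀ x, B₁ (S₁ x) + B₂ (S₂ x) + B₃ (S₃ x) = x := fun x => DFunLike.congr_fun hsum x
  obtain ⟨b11, b12, b13⟩ := hB₁
  obtain ⟨b21, b22, b23⟩ := hB₂
  obtain ⟨b31, b32, b33⟩ := hB₃
  refine ⟨?_, ?_, ?_, ?_⟩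
  · intro x y hxy
    simp only [koszul₁, Prod.mk.injEq] at hxy
    rw [← hs x, hxy.1, hxy.2.1, hxy.2.2, hs y]
  · rintro ⟨x₁, x₂, x₃⟩
    constructor
    · intro hx
      simp only [koszul₂, Prod.mk_eq_zero, sub_eq_zero] at hx
      obtain ⟨e1, e2, e3⟩ := hx
      refine ⟨B₁ x₁ + B₂ x₂ + B₃ x₃, ?_⟩
      simp only [koszul₁, map_add, Prod.mk.injEq]
      refine ⟨?_, ?_, ?_⟩
      · rw [← ap b11, ← ap b21, ← ap b31, e1, e2, hs]
      · rw [← ap b12, ← ap b22, ← ap b32, ← e1, e3, hs]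
      · rw [← ap b13, ← ap b23, ← ap b33, ← e2, ← e3, hs]
    · rintro ⟨x, hx⟩
      simp only [koszul₁, Prod.mk.injEq] at hx
      obtain ⟨rfl, rfl, rfl⟩ := hx
      simp [koszul₂, ap h₁₂, ap h₁₃, ap h₂₃]
  · rintro ⟨y₁, y₂, y₃⟩
    constructor
    · intro hy
      simp only [koszul₃] at hy
      refine ⟨(-(B₂ y₁ + B₃ y₂), B₁ y₁ - B₃ y₃, B₁ y₂ + B₂ y₃), ?_⟩
      have z1 : S₃ y₁ = S₂ y₂ - S₁ y₃ := by
        rw [← sub_eq_zero, ← hy]; abel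
      have z2 : S₂ y₂ = S₁ y₃ + S₃ y₁ := by rw [z1]; abel
      have z3 : S₁ y₃ = S₂ y₂ - S₃ y₁ := by rw [z1]; abel
      simp only [koszul₂, map_add, map_sub, map_neg, Prod.mk.injEq]
      refine ⟨?_, ?_, ?_⟩
      · rw [← ap b11, ← ap b31, ← ap b22, ← ap b32, z3, map_sub]
        nth_rewrite 4 [← hs y₁]; abel
      · rw [← ap b11, ← ap b21, ← ap b23, ← ap b33, z1, map_sub]
        nth_rewrite 4 [← hs y₂]; abel
      · rw [← ap b12, ← ap b22, ← ap b13, ← ap b33, z2, map_add]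
        nth_rewrite 4 [← hs y₃]; abel
    · rintro ⟨⟨x₁, x₂, x₃⟩, hx⟩
      simp only [koszul₂, Prod.mk.injEq] at hx
      obtain ⟨rfl, rfl, rfl⟩ := hx
      simp only [koszul₃, map_sub, ap h₁₂, ap h₁₃, ap h₂₃]
      abel
  · intro y
    refine ⟨(B₃ y, -(B₂ y), B₁ y), ?_⟩
    simp only [koszul₃, map_neg, sub_neg_eq_add]
    rw [← ap b11, ← ap b22, ← ap b33, hs]

variable {K : Type u} [NormedAddCommGroup K] [InnerProductSpace ℂ K] [CompleteSpace K]

/-- A commuting triple `(N₁, N₂, N₃)` with `N₃` unitary, `N₁ = N₂* N₃` and `σ(N₂)` in the closed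
unit disc is an `𝔼`-unitary. -/
lemma isEUnitary_of_eq_adjoint_mul {N₁ N₂ N₃ : K →L[ℂ] K} (hc : IsCommutingTriple N₁ N₂ N₃)
    (hU : N₃ ∈ unitary (K →L[ℂ] K)) (h : N₁ = star N₂ * N₃)
    (hN₂ : ∀ l : ℂ, 1 < ‖l‖ → IsUnit (N₂ - l • 1)) : IsEUnitary N₁ N₂ N₃ := by
  obtain ⟨c12, c13, c23⟩ := hc
  have hU1 : star N₃ * N₃ = 1 := Unitary.star_mul_self_of_mem hU
  have hU2 : N₃ * star N₃ = 1 := Unitary.mul_star_self_of_mem hU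
  have hsN₂ : star N₂ = N₁ * star N₃ := by rw [h, mul_assoc, hU2, mul_one]
  -- As `N₃` is unitary, commuting with `N₃` implies commuting with `N₃*`. With `N₂* = N₁ N₃*` this
  -- yields all commutation relations with adjoints, without Fuglede's theorem.
  have comm_star : ∀ {X : K →L[ℂ] K}, Commute X N₃ → Commute X (star N₃) := by
    intro X hX
    calc X * star N₃ = star N₃ * N₃ * X * star N₃ := by rw [hU1, one_mul]
      _ = star N₃ * (X * N₃) * star N₃ := by rw [hX.eq, mul_assoc (star N₃)]
      _ = star N₃ * X * (N₃ * star N₃) := by simp only [mul_assoc]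
      _ = star N₃ * X := by rw [hU2, mul_one]
  have s1 : Commute (star N₂) N₁ := by
    rw [hsN₂]; exact (Commute.refl N₁).mul_left (comm_star c13).symm
  have s2 : Commute (star N₂) N₂ := by
    rw [hsN₂]; exact c12.mul_left (comm_star c23).symm
  have s3 : Commute (star N₂) N₃ := by
    rw [hsN₂]; exact c13.mul_left (hU1.trans hU2.symm)
  refine ⟨⟨c12, c13, c23⟩, ⟨?_⟩, ⟨s2⟩, ⟨hU1.trans hU2.symm⟩, ?_⟩
  · have : star N₁ = star N₃ * N₂ := by rw [h, star_mul, star_star]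
    rw [this]
    exact (comm_star c13).symm.mul_left c12.symm
  intro l hl
  have sub_comm : ∀ {A B : K →L[ℂ] K} (a b : ℂ), Commute A B →
      Commute (A - a • 1) (B - b • 1) := fun a b hAB =>
    ((hAB.sub_right ((Commute.one_right _).smul_right b)).sub_left
      ((Commute.one_left _).smul_left a))
  have sub_comm_left : ∀ {A B : K →L[ℂ] K} (b : ℂ), Commute A B → Commute A (B - b • 1) :=
    fun b hAB => hAB.sub_right ((Commute.one_right _).smul_right b)
  have S12 := sub_comm (l 0) (l 1) c12
  have S13 := sub_comm (l 0) (l 2) c13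
  have S23 := sub_comm (l 1) (l 2) c23
  have zc : ∀ X : K →L[ℂ] K, Commute 0 X := Commute.zero_left
  have h3 : ‖l 2‖ = 1 := by
    by_contra hne
    have hu : IsUnit (N₃ - l 2 • 1) := by
      have : l 2 ∉ spectrum ℂ N₃ := fun hmem => hne (by
        simpa using Unitary.spectrum_subset_circle ⟨N₃, hU⟩ hmem)
      rw [spectrum.notMem_iff, Algebra.algebraMap_eq_smul_one] at this
      simpa using this.neg
    obtain ⟨u, hu⟩ := hu
    refine hl (isTaylorRegular_of_sum_mul_eq_one (B₁ := 0) (B₂ := 0) (B₃ := ↑u⁻¹) S12 S13 S23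
      ⟨zc _, zc _, zc _⟩ ⟨zc _, zc _, zc _⟩ ?_ ?_)
    · rw [← hu] at S13 S23 ⊢
      exact ⟨S13.symm.units_inv_left, S23.symm.units_inv_left,
        (Commute.refl (u : K →L[ℂ] K)).units_inv_left⟩
    · rw [← hu]; simp
  refine ⟨?_, h3, ?_⟩
  · by_contra hne
    set c := l 0 - conj (l 1) * l 2 with hcdef
    have hc0 : 0 < ‖c‖ := norm_pos_iff.2 (sub_ne_zero.2 hne)
    have hsN₁ : star N₁ = star N₃ * N₂ := by rw [h, star_mul, star_star]
    have star_sub_comm : ∀ {A B : K →L[ℂ] K} (a b : ℂ), Commute (star A) B →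
        Commute (star (A - a • 1)) (B - b • 1) := fun a b hAB => by
      rw [star_sub, star_smul, star_one]
      exact sub_comm _ _ hAB
    have u13 : Commute (star N₃) N₃ := hU1.trans hU2.symm
    have r1 := comm_star c13
    have r2 := comm_star c23
    have q11 := star_sub_comm (l 0) (l 0) (hsN₁ ▸ r1.symm.mul_left c12.symm)
    have q12 := star_sub_comm (l 0) (l 1) (hsN₁ ▸ r2.symm.mul_left (Commute.refl N₂))
    have q13 := star_sub_comm (l 0) (l 2) (hsN₁ ▸ u13.mul_left c23)
    have q21 := star_sub_comm (l 1) (l 0) s1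
    have q22 := star_sub_comm (l 1) (l 1) s2
    have q23 := star_sub_comm (l 1) (l 2) s3
    have q31 := star_sub_comm (l 2) (l 0) r1.symm
    have q32 := star_sub_comm (l 2) (l 1) r2.symm
    have q33 := star_sub_comm (l 2) (l 2) u13
    -- The relation `N₁ = N₂* N₃` minus its scalar counterpart, which fails by `c`: the three
    -- operators `Sᵢ` cannot be small on the same unit vector.
    have hS : star N₂ * (N₃ - l 2 • 1) + l 2 • star (N₂ - l 1 • 1) - (N₁ - l 0 • 1) = c • 1 := by
      rw [h, hcdef, star_sub, star_smul, star_one, Complex.star_def, mul_sub, mul_smul_comm,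
        mul_one, smul_sub, sub_smul, smul_smul, mul_comm (l 2)]
      abel
    set S₁ := N₁ - l 0 • 1
    set S₂ := N₂ - l 1 • 1
    set S₃ := N₃ - l 2 • 1
    set P := star S₁ * S₁ + star S₂ * S₂ + star S₃ * S₃ with hP
    have p1 : Commute P S₁ := ((q11.mul_left (Commute.refl S₁)).add_left
      (q21.mul_left S12.symm)).add_left (q31.mul_left S13.symm)
    have p2 : Commute P S₂ := ((q12.mul_left S12).add_left
      (q22.mul_left (Commute.refl S₂))).add_left (q32.mul_left S23.symm)
    have p3 : Commute P S₃ := ((q13.mul_left S13).add_left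
      (q23.mul_left S23)).add_left (q33.mul_left (Commute.refl S₃))
    have hPu : IsUnit P := by
      -- The constant comes from Cauchy–Schwarz with the weights `(‖N₂‖, 1, 1)` in the estimate
      -- `hx`.
      refine isUnit_of_re_inner_ge (c := ‖c‖ ^ 2 / (‖N₂‖ ^ 2 + 2)) (by positivity) fun x => ?_
      have e : ∀ S : K →L[ℂ] K, (inner ℂ ((star S * S) x) x).re = ‖S x‖ ^ 2 := fun S => by
        rw [ContinuousLinearMap.star_eq_adjoint, mul_apply_eq_comp,
          ContinuousLinearMap.adjoint_inner_left]
        exact inner_self_eq_norm_sq (𝕜 := ℂ) _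
      have hstar : ‖star S₂ x‖ = ‖S₂ x‖ := by
        have e' := e (star S₂)
        rw [star_star, ← q22.eq, e S₂] at e'
        exact ((sq_eq_sq₀ (norm_nonneg _) (norm_nonneg _)).1 e').symm
      have hx : ‖c‖ * ‖x‖ ≤ ‖N₂‖ * ‖S₃ x‖ + ‖S₂ x‖ + ‖S₁ x‖ := by
        calc ‖c‖ * ‖x‖ = ‖(c • (1 : K →L[ℂ] K)) x‖ := by simp [norm_smul]
          _ = ‖star N₂ (S₃ x) + l 2 • star S₂ x - S₁ x‖ := by rw [← hS]; rfl
          _ ≤ ‖star N₂ (S₃ x)‖ + ‖l 2 • star S₂ x‖ + ‖S₁ x‖ :=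
            (norm_sub_le _ _).trans (by gcongr; exact norm_add_le _ _)
          _ ≤ _ := by
            rw [norm_smul, h3, one_mul, hstar]
            gcongr
            exact ((star N₂).le_opNorm _).trans_eq (by rw [norm_star])
      rw [hP, add_apply, add_apply, inner_add_left, inner_add_left, Complex.add_re,
        Complex.add_re, e, e, e, div_mul_eq_mul_div, div_le_iff₀ (by positivity), ← mul_pow]
      refine (pow_le_pow_left₀ (by positivity) hx 2).trans ?_
      nlinarith [sq_nonneg (‖N₂‖ * ‖S₂ x‖ - ‖S₃ x‖), sq_nonneg (‖N₂‖ * ‖S₁ x‖ - ‖S₃ x‖),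
        sq_nonneg (‖S₁ x‖ - ‖S₂ x‖)]
    obtain ⟨u, hu⟩ := hPu
    rw [← hu] at p1 p2 p3
    have i1 := p1.units_inv_left
    have i2 := p2.units_inv_left
    have i3 := p3.units_inv_left
    refine hl (isTaylorRegular_of_sum_mul_eq_one (B₁ := ↑u⁻¹ * star S₁) (B₂ := ↑u⁻¹ * star S₂)
      (B₃ := ↑u⁻¹ * star S₃) S12 S13 S23
      ⟨i1.mul_left q11, i2.mul_left q12, i3.mul_left q13⟩
      ⟨i1.mul_left q21, i2.mul_left q22, i3.mul_left q23⟩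
      ⟨i1.mul_left q31, i2.mul_left q32, i3.mul_left q33⟩ ?_)
    rw [mul_assoc, mul_assoc, mul_assoc, ← mul_add, ← mul_add, ← hP, ← hu, Units.inv_mul]
  · by_contra! hlt
    obtain ⟨u, hu⟩ := hN₂ _ hlt
    refine hl (isTaylorRegular_of_sum_mul_eq_one (B₁ := 0) (B₂ := ↑u⁻¹) (B₃ := 0) S12 S13 S23
      ⟨zc _, zc _, zc _⟩ ?_ ⟨zc _, zc _, zc _⟩ ?_)
    · rw [← hu] at S12 S23 ⊢
      exact ⟨S12.symm.units_inv_left, (Commute.refl (u : K →L[ℂ] K)).units_inv_left,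
        S23.units_inv_left⟩
    · rw [← hu]; simp

end TaylorSpectrum

/-! ### Consequences of the von Neumann inequality -/

section VonNeumann

/-- If `|x₀ - w x₂| > |1 - w x₁|`, then `z = (1 - w x₁)/(x₀ - w x₂)` lies in the disc and is a zero
forbidden by the definition; the tetrablock is symmetric in `x₀` and `x₁`. All these conditions are
closed. -/
lemma closure_tetrablock_subset : closure tetrablock ⊆ {x | ∀ w : ℂ, ‖w‖ ≤ 1 →
    (‖x 0‖ ≤ 1 ∧ ‖x 0 - w * x 2‖ ≤ ‖1 - w * x 1‖) ∧
    (‖x 1‖ ≤ 1 ∧ ‖x 1 - w * x 2‖ ≤ ‖1 - w * x 0‖)} := by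
  refine closure_minimal ?_ ?_
  · have aux : ∀ a b c : ℂ, (∀ z w : ℂ, ‖z‖ ≤ 1 → ‖w‖ ≤ 1 → 1 - z * a - w * b + z * w * c ≠ 0) →
        ∀ w : ℂ, ‖w‖ ≤ 1 → ‖a‖ ≤ 1 ∧ ‖a - w * c‖ ≤ ‖1 - w * b‖ := by
      intro a b c h w hw
      have key : ∀ w : ℂ, ‖w‖ ≤ 1 → ‖a - w * c‖ ≤ ‖1 - w * b‖ := by
        intro w hw
        by_contra! hlt
        have h0 : a - w * c ≠ 0 := norm_pos_iff.1 ((norm_nonneg _).trans_lt hlt)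
        refine h ((1 - w * b) / (a - w * c)) w ?_ hw ?_
        · rw [norm_div]; exact div_le_one_of_le₀ hlt.le (norm_nonneg _)
        · field_simp; ring
      refine ⟨?_, key w hw⟩
      simpa using key 0 (by simp)
    intro x hx w hw
    refine ⟨aux _ _ _ hx w hw, aux (x 1) (x 0) (x 2) (fun z w hz hw => ?_) w hw⟩
    have := hx w z hw hz
    intro h0
    exact this (by rw [← h0]; ring)
  · simp only [Set.ofPred_forall]
    refine isClosed_iInter fun w => isClosed_iInter fun _ => ?_
    exact ((isClosed_le (by fun_prop) (by fun_prop)).and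
      (isClosed_le (by fun_prop) (by fun_prop))).and
      ((isClosed_le (by fun_prop) (by fun_prop)).and (isClosed_le (by fun_prop) (by fun_prop)))

lemma zero_mem_tetrablock : (0 : Fin 3 → ℂ) ∈ tetrablock := fun z w _ _ => by simp

variable {H : Type u} [NormedAddCommGroup H] [InnerProductSpace ℂ H] [CompleteSpace H]
  {T₁ T₂ T₃ : H →L[ℂ] H}

omit [CompleteSpace H] in
open scoped IsMulCommutative in
/-- On commuting triples `polyEval` is multiplicative: it is an algebra homomorphism. -/
lemma exists_algHom_polyEval (hc : IsCommutingTriple T₁ T₂ T₃) :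
    ∃ φ : MvPolynomial (Fin 3) ℂ →ₐ[ℂ] (H →L[ℂ] H), φ (.X 0) = T₁ ∧ φ (.X 1) = T₂ ∧
      φ (.X 2) = T₃ ∧ ∀ p, polyEval p T₁ T₂ T₃ = φ p := by
  obtain ⟨c12, c13, c23⟩ := hc
  have hcomm : ∀ a ∈ ({T₁, T₂, T₃} : Set (H →L[ℂ] H)), ∀ b ∈ ({T₁, T₂, T₃} : Set (H →L[ℂ] H)),
      a * b = b * a := by
    rintro a (rfl | rfl | rfl) b (rfl | rfl | rfl)
    exacts [rfl, c12.eq, c13.eq, c12.symm.eq, rfl, c23.eq, c13.symm.eq, c23.symm.eq, rfl]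
  -- Evaluation of polynomials needs a commutative target, here the subalgebra generated by the
  -- triple.
  let s : Set (H →L[ℂ] H) := {T₁, T₂, T₃}
  let A := Algebra.adjoin ℂ s
  have : IsMulCommutative A := Algebra.isMulCommutative_adjoin ℂ hcomm
  let t : Fin 3 → A := ![⟨T₁, Algebra.subset_adjoin (by simp [s])⟩,
    ⟨T₂, Algebra.subset_adjoin (by simp [s])⟩, ⟨T₃, Algebra.subset_adjoin (by simp [s])⟩]
  let φ : MvPolynomial (Fin 3) ℂ →ₐ[ℂ] (H →L[ℂ] H) := A.val.comp (MvPolynomial.aeval t)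
  refine ⟨φ, by simp [φ, t], by simp [φ, t], by simp [φ, t], fun p => ?_⟩
  change _ = A.val (MvPolynomial.aeval t p)
  rw [MvPolynomial.aeval_def, MvPolynomial.eval₂_eq', map_sum]
  refine Finset.sum_congr rfl fun m _ => ?_
  rw [Fin.prod_univ_three, map_mul, map_mul, map_mul, Algebra.smul_def]
  rfl

lemma norm_adjoint (X : H →L[ℂ] H) : ‖X†‖ = ‖X‖ :=
  ContinuousLinearMap.adjoint.norm_map X

lemma adjoint_mul_apply (X Y : H →L[ℂ] H) (y : H) : ((X * Y)†) y = (Y†) ((X†) y) :=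
  DFunLike.congr_fun (ContinuousLinearMap.adjoint_comp X Y) y

lemma adjoint_one : ((1 : H →L[ℂ] H)†) = 1 := star_one _

lemma adjoint_smul_apply (c : ℂ) (X : H →L[ℂ] H) (y : H) :
    ((c • X)†) y = conj c • (X†) y := by
  rw [map_smulₛₗ, smul_apply]

/-- This is the von Neumann inequality for `P/(1 - q)`, with `q = w xⱼ`, cleared of denominators.
The polynomials `P ∑_{k<N} qᵏ = P(1 - q^N)/(1 - q)` are bounded by `1 + |w|^N` on the closed
tetrablock, and `N → ∞`. -/
lemma norm_adjoint_sub_le_of_lt {φ : MvPolynomial (Fin 3) ℂ →ₐ[ℂ] (H →L[ℂ] H)}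
    (hφ : ∀ p C, (∀ x ∈ closure tetrablock, ‖MvPolynomial.eval x p‖ ≤ C) → ‖φ p‖ ≤ C)
    {i j : Fin 3} (hij : ∀ x ∈ closure tetrablock, ∀ w : ℂ, ‖w‖ ≤ 1 →
      ‖x j‖ ≤ 1 ∧ ‖x i - w * x 2‖ ≤ ‖1 - w * x j‖) {w : ℂ} (hw : ‖w‖ < 1) (y : H) :
    ‖(φ (.X i - .C w * .X 2)†) y‖ ≤ ‖(φ (1 - .C w * .X j)†) y‖ := by
  set P : MvPolynomial (Fin 3) ℂ := .X i - .C w * .X 2 with hP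
  set q : MvPolynomial (Fin 3) ℂ := .C w * .X j with hq
  have hqx : ∀ x ∈ closure tetrablock, ‖MvPolynomial.eval x q‖ ≤ ‖w‖ := fun x hx => by
    simp only [hq, map_mul, MvPolynomial.eval_C, MvPolynomial.eval_X, norm_mul]
    exact mul_le_of_le_one_right (norm_nonneg _) (hij x hx w hw.le).1
  have hqN : ∀ N : ℕ, ‖φ (q ^ N)‖ ≤ ‖w‖ ^ N := fun N => hφ _ _ fun x hx => by
    rw [map_pow, norm_pow]
    exact pow_le_pow_left₀ (norm_nonneg _) (hqx x hx) N
  have hpN : ∀ N : ℕ, ‖φ (P * ∑ k ∈ Finset.range N, q ^ k)‖ ≤ 1 + ‖w‖ ^ N := fun N =>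
    hφ _ _ fun x hx => by
      have h1 : ‖P.eval x‖ ≤ ‖1 - q.eval x‖ := by
        simpa [hP, hq] using (hij x hx w hw.le).2
      have h2 : 0 < ‖1 - q.eval x‖ := by
        have := norm_sub_norm_le (1 : ℂ) (q.eval x)
        rw [norm_one] at this
        linarith [hqx x hx]
      have h3 : ‖1 - q.eval x ^ N‖ ≤ 1 + ‖w‖ ^ N := by
        refine (norm_sub_le _ _).trans ?_
        rw [norm_one, norm_pow]
        gcongr
        exact hqx x hx
      refine le_of_mul_le_mul_right ?_ h2
      rw [← norm_mul, map_mul, map_sum, mul_assoc]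
      simp only [map_pow]
      rw [geom_sum_mul_neg, norm_mul, mul_comm]
      exact mul_le_mul h3 h1 (norm_nonneg _) (by positivity)
  have hN : ∀ N : ℕ, ‖(φ P†) y‖ ≤
      (1 + ‖w‖ ^ N) * ‖(φ (1 - q)†) y‖ + ‖w‖ ^ N * ‖(φ P†) y‖ := by
    intro N
    have e : φ (1 - q) * φ (P * ∑ k ∈ Finset.range N, q ^ k) = φ P * (1 - φ (q ^ N)) := by
      rw [← map_one φ, ← map_sub, ← map_mul, ← map_mul, ← geom_sum_mul_neg]
      congr 1; ring
    have e1 : (φ (P * ∑ k ∈ Finset.range N, q ^ k)†) ((φ (1 - q)†) y) =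
        (φ P†) y - (φ (q ^ N)†) ((φ P†) y) := by
      rw [← adjoint_mul_apply, e, adjoint_mul_apply, map_sub, adjoint_one, sub_apply,
        one_apply_eq_self]
    have e2 : (φ P†) y = (φ (P * ∑ k ∈ Finset.range N, q ^ k)†) ((φ (1 - q)†) y) +
        (φ (q ^ N)†) ((φ P†) y) := by rw [e1]; abel
    rw [e2]
    refine (norm_add_le _ _).trans ?_
    rw [← e2]
    refine add_le_add ((ContinuousLinearMap.le_opNorm _ _).trans ?_)
      ((ContinuousLinearMap.le_opNorm _ _).trans ?_)
    · rw [norm_adjoint]; gcongr; exact hpN N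
    · rw [norm_adjoint]; gcongr; exact hqN N
  have hlim := tendsto_pow_atTop_nhds_zero_of_lt_one (norm_nonneg w) hw
  have := ((hlim.const_add 1).mul_const ‖(φ (1 - q)†) y‖).add (hlim.mul_const ‖(φ P†) y‖)
  simpa using ge_of_tendsto' this hN

lemma norm_adjoint_sub_smul_le {φ : MvPolynomial (Fin 3) ℂ →ₐ[ℂ] (H →L[ℂ] H)}
    (hφ : ∀ p C, (∀ x ∈ closure tetrablock, ‖MvPolynomial.eval x p‖ ≤ C) → ‖φ p‖ ≤ C)
    {i j : Fin 3} (hij : ∀ x ∈ closure tetrablock, ∀ w : ℂ, ‖w‖ ≤ 1 →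
      ‖x j‖ ≤ 1 ∧ ‖x i - w * x 2‖ ≤ ‖1 - w * x j‖) {w : ℂ} (hw : ‖w‖ ≤ 1) (y : H) :
    ‖(φ (.X i)†) y - w • (φ (.X 2)†) y‖ ≤ ‖y - w • (φ (.X j)†) y‖ := by
  have hcl : IsClosed {w : ℂ |
      ‖(φ (.X i)†) y - w • (φ (.X 2)†) y‖ ≤ ‖y - w • (φ (.X j)†) y‖} :=
    isClosed_le (by fun_prop) (by fun_prop)
  refine closure_minimal (s := Metric.ball (0 : ℂ) 1) (fun w hw => ?_) hcl ?_
  · rw [mem_ball_zero_iff] at hw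
    -- Taking adjoints conjugates scalars, hence the estimate is used at `conj w`; the unit circle
    -- is reached by continuity.
    have h := norm_adjoint_sub_le_of_lt hφ hij (w := conj w) (by simpa using hw) y
    have hs : ∀ k, φ (.C (conj w) * .X k) = conj w • φ (.X k) := fun k => by
      rw [MvPolynomial.C_mul', map_smul]
    rw [map_sub φ, map_sub φ, hs, hs, map_one] at h
    simpa [adjoint_one, adjoint_smul_apply] using h
  · rw [closure_ball _ one_ne_zero]
    simpa using hw

/-- The estimates that characterise the points of the closed tetrablock, for the adjoint of an
`𝔼`-contraction. -/
lemma IsEContraction.norm_adjoint_sub_smul_le (h : IsEContraction T₁ T₂ T₃) {w : ℂ}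
    (hw : ‖w‖ ≤ 1) (y : H) :
    ‖(T₁†) y - w • (T₃†) y‖ ≤ ‖y - w • (T₂†) y‖ ∧
      ‖(T₂†) y - w • (T₃†) y‖ ≤ ‖y - w • (T₁†) y‖ := by
  obtain ⟨φ, h1, h2, h3, hp⟩ := exists_algHom_polyEval h.commuting
  have hφ : ∀ p C, (∀ x ∈ closure tetrablock, ‖MvPolynomial.eval x p‖ ≤ C) → ‖φ p‖ ≤ C := by
    intro p C hC
    rw [← hp]
    refine (h.von_neumann p).trans (csSup_le ?_ ?_)
    · exact ⟨_, _, subset_closure zero_mem_tetrablock, rfl⟩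
    · rintro _ ⟨x, hx, rfl⟩
      exact hC x hx
  constructor
  · have := Tetrablock.norm_adjoint_sub_smul_le hφ (i := 0) (j := 1) (fun x hx w hw =>
      ⟨(closure_tetrablock_subset hx w hw).2.1, (closure_tetrablock_subset hx w hw).1.2⟩) hw y
    rwa [h1, h2, h3] at this
  · have := Tetrablock.norm_adjoint_sub_smul_le hφ (i := 1) (j := 0) (fun x hx w hw =>
      ⟨(closure_tetrablock_subset hx w hw).1.1, (closure_tetrablock_subset hx w hw).2.2⟩) hw y
    rwa [h1, h2, h3] at this

omit [CompleteSpace H] in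
lemma re_inner_sub_le {a b c y : H} {w : ℂ} (hw : ‖w‖ = 1) (h : ‖a - w • c‖ ≤ ‖y - w • b‖) :
    ‖a‖ ^ 2 + ‖c‖ ^ 2 - 2 * (w * inner ℂ a c).re ≤
      ‖y‖ ^ 2 + ‖b‖ ^ 2 - 2 * (w * inner ℂ y b).re := by
  have h2 := pow_le_pow_left₀ (norm_nonneg _) h 2
  rw [norm_sub_sq (𝕜 := ℂ), norm_sub_sq (𝕜 := ℂ), inner_smul_right, inner_smul_right,
    norm_smul, norm_smul, hw, one_mul, one_mul, RCLike.re_to_complex, RCLike.re_to_complex] at h2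
  linarith

end VonNeumann

/-! ### Defect operators and fundamental operators -/

section Defect

variable {H : Type u} [NormedAddCommGroup H] [InnerProductSpace ℂ H] [CompleteSpace H]
  {S : H →L[ℂ] H}

lemma inner_defectOp_left (S : H →L[ℂ] H) (x y : H) :
    inner ℂ (defectOp S x) y = inner ℂ x (defectOp S y) := by
  have h : IsSelfAdjoint (defectOp S) := (CFC.sqrt_nonneg _).isSelfAdjoint
  rw [← ContinuousLinearMap.adjoint_inner_right, ← ContinuousLinearMap.star_eq_adjoint, h.star_eq]

lemma defectOp_defectOp (hS : ‖S‖ ≤ 1) (x : H) :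
    defectOp S (defectOp S x) = x - (S†) (S x) := by
  have h : (0 : H →L[ℂ] H) ≤ 1 - S† * S := by
    rw [sub_nonneg, ← ContinuousLinearMap.star_eq_adjoint]
    refine (CStarAlgebra.norm_le_one_iff_of_nonneg _ (star_mul_self_nonneg S)).1 ?_
    rw [CStarRing.norm_star_mul_self]
    exact mul_le_one₀ hS (norm_nonneg _) hS
  exact DFunLike.congr_fun (CFC.sqrt_mul_sqrt_self _ h) x

lemma norm_defectOp_sq (hS : ‖S‖ ≤ 1) (x : H) :
    ‖defectOp S x‖ ^ 2 = ‖x‖ ^ 2 - ‖S x‖ ^ 2 := by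
  rw [← inner_self_eq_norm_sq (𝕜 := ℂ), inner_defectOp_left, defectOp_defectOp hS,
    inner_sub_right, ContinuousLinearMap.adjoint_inner_right, map_sub, inner_self_eq_norm_sq,
    inner_self_eq_norm_sq]

lemma coe_defectMap (S : H →L[ℂ] H) (x : H) : (defectMap S x : H) = defectOp S x := rfl

lemma denseRange_defectMap (S : H →L[ℂ] H) : DenseRange (defectMap S) := by
  intro ξ
  rw [Metric.mem_closure_iff]
  intro ε hε
  obtain ⟨_, ⟨x, rfl⟩, hx⟩ := Metric.mem_closure_iff.1
    (show (ξ : H) ∈ closure (LinearMap.range (defectOp S).toLinearMap : Set H) from ξ.2) ε hε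
  exact ⟨_, ⟨x, rfl⟩, hx⟩

/-- `D_S` is injective on `𝒟_S`. -/
lemma defectOp_injOn {ξ : H} (hξ : ξ ∈ defectSpace S) (h : defectOp S ξ = 0) : ξ = 0 := by
  have hcl : IsClosed {η : defectSpace S | inner ℂ ξ (η : H) = 0} :=
    isClosed_eq (by fun_prop) continuous_const
  have := (denseRange_defectMap S).induction_on (p := fun η => inner ℂ ξ (η : H) = 0)
    ⟨ξ, hξ⟩ hcl fun x => by
      rw [coe_defectMap, ← inner_defectOp_left, h, inner_zero_left]
  exact inner_self_eq_zero.1 this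

variable {T₁ T₂ T : H →L[ℂ] H} {A₁ A₂ : defectSpace (T†) →L[ℂ] defectSpace (T†)}

/-- The joint numerical range estimate for the fundamental operators of the adjoint of an
`𝔼`-contraction. -/
lemma IsEContraction.re_inner_fundamentalOperators_le (h : IsEContraction T₁ T₂ T)
    (hT : ‖T‖ ≤ 1) (hA : AreFundamentalOperators (T₁†) (T₂†) (T†) A₁ A₂) {z w : ℂ}
    (hz : ‖z‖ = 1) (hw : ‖w‖ = 1) (ξ : defectSpace (T†)) :
    (z * inner ℂ ξ (A₁ ξ)).re + (w * inner ℂ ξ (A₂ ξ)).re ≤ ‖ξ‖ ^ 2 := by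
  have hT' : ‖T†‖ ≤ 1 := (norm_adjoint T).trans_le hT
  refine (denseRange_defectMap (T†)).induction_on ξ (isClosed_le (by fun_prop) (by fun_prop))
    fun y => ?_
  -- When the two squared estimates are added, `‖T₁*y‖²` and `‖T₂*y‖²` cancel; what is left is twice
  -- the claim at `ξ = D y`.
  have h1 := re_inner_sub_le hw (h.norm_adjoint_sub_smul_le hw.le y).1
  have h2 := re_inner_sub_le hz (h.norm_adjoint_sub_smul_le hz.le y).2
  have f1 : inner ℂ (defectMap (T†) y) (A₁ (defectMap (T†) y)) =
      inner ℂ y ((T₁†) y) - inner ℂ ((T₂†) y) ((T†) y) := by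
    rw [Submodule.coe_inner, coe_defectMap, inner_defectOp_left, ← hA.1 y, inner_sub_right,
      ContinuousLinearMap.adjoint_inner_right (T₂†)]
  have f2 : inner ℂ (defectMap (T†) y) (A₂ (defectMap (T†) y)) =
      inner ℂ y ((T₂†) y) - inner ℂ ((T₁†) y) ((T†) y) := by
    rw [Submodule.coe_inner, coe_defectMap, inner_defectOp_left, ← hA.2 y, inner_sub_right,
      ContinuousLinearMap.adjoint_inner_right (T₁†)]
  have f3 : ‖defectMap (T†) y‖ ^ 2 = ‖y‖ ^ 2 - ‖(T†) y‖ ^ 2 := norm_defectOp_sq hT' y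
  rw [f1, f2, f3, mul_sub, mul_sub, Complex.sub_re, Complex.sub_re]
  linarith

lemma AreFundamentalOperators.defectOp_adjoint (hA : AreFundamentalOperators (T₁†) (T₂†) (T†) A₁ A₂)
    (x : H) : defectOp (T†) ((A₂†) (defectMap (T†) x) : H) = T₂ x - T ((T₁†) x) := by
  refine ext_inner_right ℂ fun v => ?_
  rw [inner_defectOp_left, ← coe_defectMap, ← Submodule.coe_inner,
    ContinuousLinearMap.adjoint_inner_left, Submodule.coe_inner, coe_defectMap,
    inner_defectOp_left, ← hA.2 v, inner_sub_right, inner_sub_left,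
    ContinuousLinearMap.adjoint_inner_right, ContinuousLinearMap.adjoint_inner_right,
    ← ContinuousLinearMap.adjoint_inner_right T]

/-- The identity `D_{T*} T₁* = A₁ D_{T*} + A₂* D_{T*} T*`. -/
lemma AreFundamentalOperators.defectMap_adjoint (hT : ‖T‖ ≤ 1) (hc : Commute T₁ T)
    (hA : AreFundamentalOperators (T₁†) (T₂†) (T†) A₁ A₂) (h : H) :
    defectMap (T†) ((T₁†) h) =
      A₁ (defectMap (T†) h) + (A₂†) (defectMap (T†) ((T†) h)) := by
  have hT' : ‖T†‖ ≤ 1 := (norm_adjoint T).trans_le hT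
  have hcomm : (T₁†) ((T†) h) = (T†) ((T₁†) h) := by
    rw [← adjoint_mul_apply, ← hc.eq, adjoint_mul_apply]
  rw [← sub_eq_zero]
  -- Since `D` is injective on the defect space, it may be applied to both sides; then the defining
  -- relation of `A₁`, the adjoint of that of `A₂`, and `D² = I - T T*` make all terms cancel.
  suffices defectOp (T†) ((defectMap (T†) ((T₁†) h) - (A₁ (defectMap (T†) h) +
      (A₂†) (defectMap (T†) ((T†) h))) : defectSpace (T†)) : H) = 0 from
    Subtype.ext (defectOp_injOn (SetLike.coe_mem _) this)
  rw [Submodule.coe_sub, Submodule.coe_add, map_sub, map_add, coe_defectMap,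
    defectOp_defectOp hT', ← hA.1 h, hA.defectOp_adjoint]
  simp [hcomm]

end Defect

/-! ### The bilateral shift as a unitary extension of `M_z` -/

section BilateralShift

/-- The space `ℓ²(ℤ)`. -/
abbrev BilateralEllTwo : Type := lp (fun _ : ℤ => ℂ) 2

lemma hasSum_norm_sq_shift (k : ℤ) (a : BilateralEllTwo) :
    HasSum (fun n : ℤ => ‖a (n + k)‖ ^ (2 : ℝ≥0∞).toReal) (‖a‖ ^ (2 : ℝ≥0∞).toReal) :=
  (Equiv.addRight k).hasSum_iff.2 (lp.hasSum_norm (by norm_num) a)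

/-- Translation by `k` on `ℓ²(ℤ)`. -/
noncomputable def translation (k : ℤ) : BilateralEllTwo →ₗᵢ[ℂ] BilateralEllTwo where
  toFun a := ⟨fun n => a (n + k), memℓp_gen (hasSum_norm_sq_shift k a).summable⟩
  map_add' _ _ := rfl
  map_smul' _ _ := rfl
  norm_map' a := by
    have h := (lp.hasSum_norm (p := 2) (by norm_num) (⟨fun n => a (n + k),
      memℓp_gen (hasSum_norm_sq_shift k a).summable⟩ : BilateralEllTwo)).unique
      (hasSum_norm_sq_shift k a)
    exact (Real.rpow_left_inj (norm_nonneg _) (norm_nonneg _) (by norm_num)).1 h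

lemma translation_apply (k : ℤ) (a : BilateralEllTwo) (n : ℤ) : translation k a n = a (n + k) :=
  rfl

/-- The bilateral shift on `ℓ²(ℤ)`. -/
noncomputable def bilateralShift : BilateralEllTwo ≃ₗᵢ[ℂ] BilateralEllTwo :=
  LinearIsometryEquiv.ofSurjective (translation (-1)) fun a => ⟨translation 1 a, by
    ext n; simp [translation_apply]⟩

/-- The bilateral shift as a bounded operator. -/
noncomputable def bilateralShiftL : BilateralEllTwo →L[ℂ] BilateralEllTwo :=
  (bilateralShift : BilateralEllTwo →L[ℂ] BilateralEllTwo)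

lemma bilateralShiftL_mem_unitary :
    bilateralShiftL ∈ unitary (BilateralEllTwo →L[ℂ] BilateralEllTwo) :=
  (Unitary.linearIsometryEquiv.symm bilateralShift).2

/-- The extension by zero of a sequence to negative indices. -/
noncomputable def extendSeq (a : ℕ → ℂ) : ℤ → ℂ := Int.rec a fun _ => 0

lemma hasSum_norm_sq_extendSeq (a : EllTwo) :
    HasSum (fun n : ℤ => ‖extendSeq a n‖ ^ (2 : ℝ≥0∞).toReal) (‖a‖ ^ (2 : ℝ≥0∞).toReal) := by
  have h := (lp.hasSum_norm (p := 2) (by norm_num) a).int_rec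
    (hasSum_zero : HasSum (fun _ : ℕ => (0 : ℝ)) 0)
  rw [add_zero] at h
  convert h using 1
  ext n
  cases n <;> simp [extendSeq]

/-- The embedding of `H²(𝔻)` into `ℓ²(ℤ)`. -/
noncomputable def hardyEmbedding : HardySpace →ₗᵢ[ℂ] BilateralEllTwo where
  toFun f := ⟨extendSeq (HardySpace.coeffs f),
    memℓp_gen (hasSum_norm_sq_extendSeq (HardySpace.coeffs f)).summable⟩
  map_add' f g := by
    ext (n | n)
    · change HardySpace.coeffs (f + g) n = HardySpace.coeffs f n + HardySpace.coeffs g n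
      simp
    · exact (add_zero 0).symm
  map_smul' c f := by
    ext (n | n)
    · change HardySpace.coeffs (c • f) n = c * HardySpace.coeffs f n
      simp
    · exact (mul_zero c).symm
  norm_map' f := by
    have h := (lp.hasSum_norm (p := 2) (by norm_num) (⟨extendSeq (HardySpace.coeffs f),
      memℓp_gen (hasSum_norm_sq_extendSeq (HardySpace.coeffs f)).summable⟩ :
        BilateralEllTwo)).unique (hasSum_norm_sq_extendSeq (HardySpace.coeffs f))
    exact (Real.rpow_left_inj (norm_nonneg _) (norm_nonneg _) (by norm_num)).1 h

lemma hardyEmbedding_apply (f : HardySpace) (n : ℤ) :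
    hardyEmbedding f n = extendSeq (HardySpace.coeffs f) n := rfl

lemma HardySpace.coeffs_Mz (f : HardySpace) :
    HardySpace.coeffs (HardySpace.Mz f) = HardySpace.shiftSeq (HardySpace.coeffs f) :=
  HardySpace.coeffs_eq fun z => HardySpace.hasSum_shiftSeq f z

lemma bilateralShiftL_hardyEmbedding (f : HardySpace) :
    bilateralShiftL (hardyEmbedding f) = hardyEmbedding (HardySpace.Mz f) := by
  ext n
  change hardyEmbedding f (n - 1) = _
  rw [hardyEmbedding_apply, hardyEmbedding_apply, HardySpace.coeffs_Mz]
  -- At `n = 0` the left side reads the entry of index `-1`, which is zero like the leading entry of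
  -- the shifted sequence.
  rcases n with (_ | k) | k
  · rfl
  · have : (Int.ofNat (k + 1) - 1 : ℤ) = Int.ofNat k := by simp
    rw [this]; rfl
  · have : (Int.negSucc k - 1 : ℤ) = Int.negSucc (k + 1) := by omega
    rw [this]; rfl

end BilateralShift

/-! ### Operator pencils built from the fundamental operators -/

section Pencil

variable {E F : Type*} [NormedAddCommGroup E] [InnerProductSpace ℂ E]
  [NormedAddCommGroup F] [InnerProductSpace ℂ F]

lemma pencil_mul_pencil (M : E →L[ℂ] E) (B C B' C' : F →L[ℂ] F) :
    (opTensor 1 B + opTensor M C) * (opTensor 1 B' + opTensor M C') =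
      opTensor 1 (B * B') + opTensor M (B * C' + C * B') + opTensor (M * M) (C * C') := by
  simp only [mul_add, add_mul, opTensor_mul, opTensor_add_right, one_mul, mul_one]
  abel

lemma commute_pencil_opTensor (M : E →L[ℂ] E) (B C : F →L[ℂ] F) :
    Commute (opTensor 1 B + opTensor M C) (opTensor M 1) := by
  change _ * _ = _ * _
  simp only [mul_add, add_mul, opTensor_mul, one_mul, mul_one]

variable [CompleteSpace F] {A₁ A₂ : F →L[ℂ] F}

/-- Compare coefficients in the two products of pencils: those of `1` and `M²` agree because `A₁`
and `A₂` commute, that of `M` by the equality of the self-commutators. -/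
lemma isCommutingTriple_pencil (M : E →L[ℂ] E) (hcomm : A₁ * A₂ = A₂ * A₁)
    (hbracket : A₁† * A₁ - A₁ * A₁† = A₂† * A₂ - A₂ * A₂†) :
    IsCommutingTriple (opTensor 1 (A₁†) + opTensor M A₂) (opTensor 1 (A₂†) + opTensor M A₁)
      (opTensor M 1) := by
  refine ⟨?_, commute_pencil_opTensor M _ _, commute_pencil_opTensor M _ _⟩
  have h1 : A₁† * A₂† = A₂† * A₁† := by
    have := congrArg star hcomm
    rw [star_mul, star_mul] at this
    exact this.symm
  have h2 : A₁† * A₁ + A₂ * A₂† = A₂† * A₂ + A₁ * A₁† := by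
    rw [← sub_eq_zero] at hbracket ⊢
    rw [← hbracket]; abel
  rw [Commute, SemiconjBy, pencil_mul_pencil, pencil_mul_pencil, h1, h2, hcomm]

lemma adjoint_mul_self_opTensor [CompleteSpace E] {M : E →L[ℂ] E} (hM : M† * M = 1) :
    (opTensor M (1 : F →L[ℂ] F))† * opTensor M 1 = 1 := by
  rw [adjoint_opTensor, opTensor_mul, hM, adjoint_one, one_mul, opTensor_one]

/-- The numerical radius of the pencil `A₂* + M A₁` is at most one. -/
lemma re_inner_pencil_le [CompleteSpace E] {M : E →L[ℂ] E} (hM : M† * M = 1)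
    (hA : ∀ z w : ℂ, ‖z‖ = 1 → ‖w‖ = 1 → ∀ ξ : F,
      (z * inner ℂ ξ (A₁ ξ)).re + (w * inner ℂ ξ (A₂ ξ)).re ≤ ‖ξ‖ ^ 2)
    {β : ℂ} (hβ : ‖β‖ = 1) (f : HilbertTensor E F) :
    (inner ℂ ((β • (opTensor 1 (A₂†) + opTensor M A₁) :
      HilbertTensor E F →L[ℂ] HilbertTensor E F) f) f).re ≤ ‖f‖ ^ 2 := by
  have e : β • (opTensor 1 (A₂†) + opTensor M A₁) =
      opTensor 1 (β • A₂†) + opTensor M (1 : F →L[ℂ] F) * opTensor 1 (β • A₁) := by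
    rw [opTensor_mul, mul_one, one_mul, opTensor_smul_right, opTensor_smul_right, smul_add]
  have hcomm : ∀ X : F →L[ℂ] F, Commute (opTensor M (1 : F →L[ℂ] F)) (opTensor 1 X) := fun X => by
    rw [Commute, SemiconjBy, opTensor_mul, opTensor_mul, mul_one, one_mul, mul_one, one_mul]
  rw [e]
  refine re_inner_add_mul_le (fun x y => ?_) (hcomm _) (hcomm _) (fun ζ hζ g => ?_) f
  · rw [← ContinuousLinearMap.adjoint_inner_right, ← mul_apply_eq_comp,
      adjoint_mul_self_opTensor hM, one_apply_eq_self]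
  · rw [← opTensor_smul_right, ← opTensor_add_right]
    refine re_inner_opTensor_one_le (fun ξ => ?_) g
    -- The second parameter is `conj β` because `A₂` enters the pencil through its adjoint.
    have h := hA (ζ * β) (conj β) (by rw [norm_mul, hζ, hβ, one_mul]) (by simpa using hβ) ξ
    have h1 : (inner ℂ ((ζ • β • A₁) ξ) ξ).re = (ζ * β * inner ℂ ξ (A₁ ξ)).re := by
      rw [smul_smul, smul_apply, ← inner_conj_symm, inner_smul_right, Complex.conj_re]
    have h2 : inner ℂ ((β • A₂†) ξ) ξ = conj β * inner ℂ ξ (A₂ ξ) := by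
      rw [smul_apply, inner_smul_left, ContinuousLinearMap.adjoint_inner_left]
    rw [add_apply, inner_add_left, Complex.add_re, h1, h2]
    linarith

end Pencil

/-! ### The model triple is an `𝔼`-isometry -/

section PureIsometry

variable {F : Type u} [NormedAddCommGroup F] [InnerProductSpace ℂ F] [CompleteSpace F]
  {A₁ A₂ : F →L[ℂ] F}

lemma isEUnitary_pencil {L : Type} [NormedAddCommGroup L] [InnerProductSpace ℂ L]
    [CompleteSpace L] {M : L →L[ℂ] L} (hM : M ∈ unitary (L →L[ℂ] L))
    (hcomm : A₁ * A₂ = A₂ * A₁)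
    (hbracket : A₁† * A₁ - A₁ * A₁† = A₂† * A₂ - A₂ * A₂†)
    (hA : ∀ z w : ℂ, ‖z‖ = 1 → ‖w‖ = 1 → ∀ ξ : F,
      (z * inner ℂ ξ (A₁ ξ)).re + (w * inner ℂ ξ (A₂ ξ)).re ≤ ‖ξ‖ ^ 2) :
    IsEUnitary (opTensor 1 (A₁†) + opTensor M A₂) (opTensor 1 (A₂†) + opTensor M A₁)
      (opTensor M 1) := by
  have hM1 : M† * M = 1 := Unitary.star_mul_self_of_mem hM
  have hM2 : M * M† = 1 := Unitary.mul_star_self_of_mem hM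
  refine isEUnitary_of_eq_adjoint_mul (isCommutingTriple_pencil M hcomm hbracket)
    (Unitary.mem_iff.2 ⟨adjoint_mul_self_opTensor hM1, ?_⟩) ?_ fun l hl =>
      isUnit_sub_of_numericalRadius_le (fun β hβ f => re_inner_pencil_le hM1 hA hβ f) hl
  · rw [ContinuousLinearMap.star_eq_adjoint, adjoint_opTensor, opTensor_mul, hM2, adjoint_one,
      one_mul, opTensor_one]
  · rw [ContinuousLinearMap.star_eq_adjoint, map_add, adjoint_opTensor, adjoint_opTensor,
      ContinuousLinearMap.adjoint_adjoint, adjoint_one, add_mul, opTensor_mul, opTensor_mul, hM1,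
      one_mul, mul_one, mul_one, add_comm]

lemma isEIsometry_pencil (hcomm : A₁ * A₂ = A₂ * A₁)
    (hbracket : A₁† * A₁ - A₁ * A₁† = A₂† * A₂ - A₂ * A₂†)
    (hA : ∀ z w : ℂ, ‖z‖ = 1 → ‖w‖ = 1 → ∀ ξ : F,
      (z * inner ℂ ξ (A₁ ξ)).re + (w * inner ℂ ξ (A₂ ξ)).re ≤ ‖ξ‖ ^ 2) :
    IsEIsometry (opTensor 1 (A₁†) + opTensor HardySpace.Mz A₂)
      (opTensor 1 (A₂†) + opTensor HardySpace.Mz A₁)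
      (opTensor HardySpace.Mz (1 : F →L[ℂ] F)) := by
  refine ⟨isCommutingTriple_pencil _ hcomm hbracket,
    HilbertTensor BilateralEllTwo F, inferInstance, inferInstance, inferInstance, _, _, _,
    isometryTensor hardyEmbedding LinearIsometry.id,
    isEUnitary_pencil bilateralShiftL_mem_unitary hcomm hbracket hA, fun t => ?_⟩
  have h1 : ∀ (X : F →L[ℂ] F), opTensor 1 X
      (isometryTensor hardyEmbedding LinearIsometry.id t) =
      isometryTensor hardyEmbedding LinearIsometry.id (opTensor 1 X t) := fun X =>
    isometryTensor_opTensor (fun _ => rfl) (fun _ => rfl) t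
  have hM : ∀ (X : F →L[ℂ] F), opTensor bilateralShiftL X
      (isometryTensor hardyEmbedding LinearIsometry.id t) =
      isometryTensor hardyEmbedding LinearIsometry.id (opTensor HardySpace.Mz X t) := fun X =>
    isometryTensor_opTensor bilateralShiftL_hardyEmbedding (fun _ => rfl) t
  refine ⟨?_, ?_, hM 1⟩
  · rw [add_apply, add_apply, h1, hM, map_add]
  · rw [add_apply, add_apply, h1, hM, map_add]

end PureIsometry

/-! ### Monomials in the Hardy space -/

section Monomials

/-- The function `zⁿ` in the Hardy space. -/
noncomputable def HardySpace.monomial (n : ℕ) : HardySpace :=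
  HardySpace.coeffs.symm (lp.single 2 n 1)

lemma HardySpace.coeffs_monomial (n : ℕ) :
    HardySpace.coeffs (HardySpace.monomial n) = lp.single 2 n 1 :=
  HardySpace.coeffs.apply_symm_apply _

lemma HardySpace.Mz_monomial (n : ℕ) :
    HardySpace.Mz (HardySpace.monomial n) = HardySpace.monomial (n + 1) := by
  refine HardySpace.coeffs.injective ?_
  rw [HardySpace.coeffs_Mz, HardySpace.coeffs_monomial, HardySpace.coeffs_monomial]
  ext k
  cases k with
  | zero => simp [HardySpace.shiftSeq]
  | succ k =>
    change (lp.single 2 n (1 : ℂ) : EllTwo) k = _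
    simp [Pi.single_apply]

lemma HardySpace.inner_monomial (n m : ℕ) :
    inner ℂ (HardySpace.monomial n) (HardySpace.monomial m) = if n = m then (1 : ℂ) else 0 := by
  rw [← HardySpace.inner_coeffs, HardySpace.coeffs_monomial, HardySpace.coeffs_monomial,
    lp.inner_single_left]
  simp [Pi.single_apply]

lemma HardySpace.hasSum_monomial (f : HardySpace) :
    HasSum (fun n => HardySpace.coeffs f n • HardySpace.monomial n) f := by
  have h := (lp.hasSum_single (by norm_num) (HardySpace.coeffs f)).mapL
    (HardySpace.coeffsIsometry.symm.toContinuousLinearEquiv : EllTwo →L[ℂ] HardySpace)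
  convert h using 1
  · ext1 n
    change _ = HardySpace.coeffs.symm _
    rw [HardySpace.monomial, ← map_smul, ← lp.single_smul, smul_eq_mul, mul_one]
  · exact (HardySpace.coeffs.symm_apply_apply f).symm

variable {F : Type*} [NormedAddCommGroup F] [InnerProductSpace ℂ F]

lemma eq_top_of_monomial_mem {S : Submodule ℂ (HilbertTensor HardySpace F)}
    (hS : IsClosed (S : Set (HilbertTensor HardySpace F)))
    (h : ∀ n y, elemTensor (HardySpace.monomial n) y ∈ S) : S = ⊤ := by
  refine eq_top_of_elemTensor_mem hS fun f y => ?_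
  have hf := (HardySpace.hasSum_monomial f).mapL (elemTensor.flip y)
  refine hS.mem_of_tendsto hf (Filter.Eventually.of_forall fun s => S.sum_mem fun n _ => ?_)
  rw [map_smul]
  exact S.smul_mem _ (h n y)

lemma ext_monomial {X : Type*} [NormedAddCommGroup X] [NormedSpace ℂ X]
    {f g : HilbertTensor HardySpace F →L[ℂ] X}
    (h : ∀ n y, f (elemTensor (HardySpace.monomial n) y) =
      g (elemTensor (HardySpace.monomial n) y)) : f = g := by
  have : LinearMap.eqLocus f.toLinearMap g.toLinearMap = ⊤ :=
    eq_top_of_monomial_mem (isClosed_eq f.continuous g.continuous) h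
  ext t
  exact (this ▸ Submodule.mem_top : t ∈ LinearMap.eqLocus f.toLinearMap g.toLinearMap)

/-- The embedding `y ↦ zⁿ ⊗ y`. -/
noncomputable def monomialTensor (n : ℕ) : F →ₗᵢ[ℂ] HilbertTensor HardySpace F where
  toLinearMap := (elemTensor (HardySpace.monomial n)).toLinearMap
  norm_map' y := by
    change ‖elemTensor (HardySpace.monomial n) y‖ = ‖y‖
    rw [← sq_eq_sq₀ (norm_nonneg _) (norm_nonneg _), ← inner_self_eq_norm_sq (𝕜 := ℂ),
      inner_elemTensor, HardySpace.inner_monomial, if_pos rfl, one_mul, inner_self_eq_norm_sq]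

lemma monomialTensor_apply (n : ℕ) (y : F) :
    monomialTensor n y = elemTensor (HardySpace.monomial n) y := rfl

lemma orthogonalFamily_monomialTensor :
    OrthogonalFamily ℂ (fun _ : ℕ => F) (fun n => monomialTensor (F := F) n) := by
  intro n m hnm x y
  rw [monomialTensor_apply, monomialTensor_apply, inner_elemTensor, HardySpace.inner_monomial,
    if_neg hnm, zero_mul]

end Monomials

/-! ### `M_z ⊗ I` is a pure isometry -/

section Shift

variable {F : Type u} [NormedAddCommGroup F] [InnerProductSpace ℂ F] [CompleteSpace F]

lemma norm_opTensor_Mz_apply (t : HilbertTensor HardySpace F) :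
    ‖opTensor HardySpace.Mz (1 : F →L[ℂ] F) t‖ = ‖t‖ := by
  have hM : HardySpace.Mz† * HardySpace.Mz = 1 := by
    refine (ContinuousLinearMap.norm_map_iff_adjoint_comp_self HardySpace.Mz).1 fun f => ?_
    rw [← HardySpace.norm_coeffs, HardySpace.coeffs_Mz, HardySpace.norm_shiftSeq,
      HardySpace.norm_coeffs]
  exact (ContinuousLinearMap.norm_map_iff_adjoint_comp_self _).2 (adjoint_mul_self_opTensor hM) t

omit [CompleteSpace F] in
lemma opTensor_Mz_pow_monomial (n k : ℕ) (y : F) :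
    (opTensor HardySpace.Mz (1 : F →L[ℂ] F) ^ n) (elemTensor (HardySpace.monomial k) y) =
      elemTensor (HardySpace.monomial (n + k)) y := by
  induction n with
  | zero => simp
  | succ n ih =>
    rw [pow_succ', mul_apply_eq_comp, ih, opTensor_elemTensor, HardySpace.Mz_monomial,
      one_apply_eq_self, Nat.add_right_comm]

lemma isPureContraction_opTensor_Mz :
    IsPureContraction (opTensor HardySpace.Mz (1 : F →L[ℂ] F)) := by
  set V := opTensor HardySpace.Mz (1 : F →L[ℂ] F)
  have hV : ‖V‖ ≤ 1 := V.opNorm_le_bound zero_le_one fun t => by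
    rw [norm_opTensor_Mz_apply, one_mul]
  have hVn : ∀ (n : ℕ) t, ‖((V†) ^ n) t‖ ≤ ‖t‖ := fun n => by
    induction n with
    | zero => exact fun t => le_rfl
    | succ n ih =>
      intro t
      rw [pow_succ, mul_apply_eq_comp]
      refine (ih _).trans ((ContinuousLinearMap.le_of_opNorm_le _ (c := 1) ?_ t).trans_eq
        (one_mul _))
      rwa [norm_adjoint]
  refine ⟨hV, ?_⟩
  let S : Submodule ℂ (HilbertTensor HardySpace F) :=
    { carrier := {t | Filter.Tendsto (fun n : ℕ => ((V†) ^ n) t) Filter.atTop (𝓝 0)}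
      add_mem' := fun {a b} ha hb => by
        simpa only [Set.mem_ofPred_eq, map_add, add_zero] using Filter.Tendsto.add ha hb
      zero_mem' := by simp
      smul_mem' := fun c a ha => by
        simpa only [Set.mem_ofPred_eq, map_smul, smul_zero] using
          Filter.Tendsto.const_smul ha c }
  -- The powers of `V*` are uniformly bounded, so strong convergence to zero passes to limits of
  -- vectors.
  have hcl : IsClosed (S : Set (HilbertTensor HardySpace F)) := by
    refine isClosed_of_closure_subset fun t ht => ?_
    refine Metric.tendsto_atTop.2 fun ε hε => ?_
    obtain ⟨s, hs, hts⟩ := Metric.mem_closure_iff.1 ht (ε / 2) (half_pos hε)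
    obtain ⟨N, hN⟩ := Metric.tendsto_atTop.1 (show Filter.Tendsto (fun n : ℕ => ((V†) ^ n) s)
      Filter.atTop (𝓝 0) from hs) (ε / 2) (half_pos hε)
    refine ⟨N, fun n hn => ?_⟩
    have h1 := hN n hn
    rw [dist_zero_right] at h1 ⊢
    have h2 := hVn n (t - s)
    rw [dist_eq_norm] at hts
    calc ‖((V†) ^ n) t‖ = ‖((V†) ^ n) (t - s) + ((V†) ^ n) s‖ := by rw [← map_add, sub_add_cancel]
      _ ≤ ‖((V†) ^ n) (t - s)‖ + ‖((V†) ^ n) s‖ := norm_add_le _ _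
      _ < ε := by linarith
  -- `V*ⁿ` annihilates `zᵏ ⊗ y` once `n > k`, as the range of `Vⁿ` involves only powers `z^m` with
  -- `m ≥ n`.
  have hS : S = ⊤ := eq_top_of_monomial_mem hcl fun k y => by
    refine tendsto_atTop_of_eventually_const (i₀ := k + 1) fun n hn => ?_
    have hadj : (V†) ^ n = (V ^ n)† := (star_pow V n).symm
    refine ext_inner_right ℂ fun t => ?_
    rw [hadj, ContinuousLinearMap.adjoint_inner_left, inner_zero_left]
    have : (innerSL ℂ (elemTensor (HardySpace.monomial k) y)) ∘L V ^ n = 0 :=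
      ext_monomial fun m y' => by
        rw [ContinuousLinearMap.comp_apply, opTensor_Mz_pow_monomial, innerSL_apply_apply,
          inner_elemTensor, HardySpace.inner_monomial, if_neg (by omega), zero_mul, zero_apply]
    exact DFunLike.congr_fun this t
  intro t
  exact (hS ▸ Submodule.mem_top : t ∈ S)

lemma isometry_opTensor_Mz : Isometry (opTensor HardySpace.Mz (1 : F →L[ℂ] F)) :=
  AddMonoidHomClass.isometry_of_norm _ norm_opTensor_Mz_apply

end Shift

/-! ### The dilation isometry, its intertwining relations and minimality -/

section Dilation

variable {H F : Type u} [NormedAddCommGroup H] [InnerProductSpace ℂ H] [CompleteSpace H]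
  [NormedAddCommGroup F] [InnerProductSpace ℂ F]
  {T₁ T : H →L[ℂ] H} {D : H →L[ℂ] F}

/-- The sum telescopes to `‖h‖² - lim ‖T*ⁿ h‖²`, and the limit is zero by purity. -/
lemma IsPureContraction.hasSum_norm_defect (hT : IsPureContraction T)
    (hD : ∀ x, ‖D x‖ ^ 2 = ‖x‖ ^ 2 - ‖(T†) x‖ ^ 2) (h : H) :
    HasSum (fun n : ℕ => ‖D (((T†) ^ n) h)‖ ^ (2 : ℝ≥0∞).toReal)
      (‖h‖ ^ (2 : ℝ≥0∞).toReal) := by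
  simp only [ENNReal.toReal_ofNat, Real.rpow_ofNat]
  have e : ∀ n : ℕ, ‖D (((T†) ^ n) h)‖ ^ 2 =
      ‖((T†) ^ n) h‖ ^ 2 - ‖((T†) ^ (n + 1)) h‖ ^ 2 := fun n => by
    rw [hD, pow_succ' (T†), mul_apply_eq_comp]
  rw [hasSum_iff_tendsto_nat_of_nonneg fun n => sq_nonneg _]
  simp only [e, Finset.sum_range_sub', pow_zero, one_apply_eq_self]
  simpa using ((hT.2 h).norm.pow 2).const_sub (‖h‖ ^ 2)

/-- The isometry `h ↦ (D T*ⁿ h)ₙ` of a pure contraction `T`, where `D* D = I - T T*`. -/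
noncomputable def IsPureContraction.defectSeq (hT : IsPureContraction T)
    (hD : ∀ x, ‖D x‖ ^ 2 = ‖x‖ ^ 2 - ‖(T†) x‖ ^ 2) :
    H →ₗᵢ[ℂ] lp (fun _ : ℕ => F) 2 where
  toFun h := ⟨fun n => D (((T†) ^ n) h), memℓp_gen (hT.hasSum_norm_defect hD h).summable⟩
  map_add' x y := by
    ext1
    funext n
    change D (((T†) ^ n) (x + y)) = _
    rw [map_add, map_add]; rfl
  map_smul' c x := by
    ext1
    funext n
    change D (((T†) ^ n) (c • x)) = _
    rw [map_smul, map_smul]; rfl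
  norm_map' h := by
    have := (lp.hasSum_norm (p := 2) (by norm_num) (⟨fun n => D (((T†) ^ n) h),
      memℓp_gen (hT.hasSum_norm_defect hD h).summable⟩ :
        lp (fun _ : ℕ => F) 2)).unique (hT.hasSum_norm_defect hD h)
    exact (Real.rpow_left_inj (norm_nonneg _) (norm_nonneg _) (by norm_num)).1 this

variable [CompleteSpace F]

/-- The isometry `W h = ∑ zⁿ ⊗ D T*ⁿ h` of a pure contraction `T`, where `D* D = I - T T*`. -/
noncomputable def IsPureContraction.dilationIsometry (hT : IsPureContraction T)
    (hD : ∀ x, ‖D x‖ ^ 2 = ‖x‖ ^ 2 - ‖(T†) x‖ ^ 2) : H →ₗᵢ[ℂ] HilbertTensor HardySpace F :=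
  orthogonalFamily_monomialTensor.linearIsometry.comp (hT.defectSeq hD)

omit [CompleteSpace F] in
lemma IsPureContraction.hasSum_dilationIsometry (hT : IsPureContraction T)
    (hD : ∀ x, ‖D x‖ ^ 2 = ‖x‖ ^ 2 - ‖(T†) x‖ ^ 2) (h : H) :
    HasSum (fun n => elemTensor (HardySpace.monomial n) (D (((T†) ^ n) h)))
      (hT.dilationIsometry hD h) :=
  orthogonalFamily_monomialTensor.hasSum_linearIsometry (hT.defectSeq hD h)

lemma IsPureContraction.adjoint_dilationIsometry_monomial (hT : IsPureContraction T)
    (hD : ∀ x, ‖D x‖ ^ 2 = ‖x‖ ^ 2 - ‖(T†) x‖ ^ 2) (n : ℕ) (ξ : F) :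
    ((hT.dilationIsometry hD).toContinuousLinearMap†) (elemTensor (HardySpace.monomial n) ξ) =
      (T ^ n) ((D†) ξ) := by
  refine ext_inner_right ℂ fun h => ?_
  have hadj : (T†) ^ n = (T ^ n)† := (star_pow T n).symm
  rw [ContinuousLinearMap.adjoint_inner_left, ← monomialTensor_apply,
    ← orthogonalFamily_monomialTensor.linearIsometry_apply_single ξ]
  change inner ℂ _ (orthogonalFamily_monomialTensor.linearIsometry (hT.defectSeq hD h)) = _
  rw [LinearIsometry.inner_map_map, lp.inner_single_left]
  change inner ℂ ξ (D (((T†) ^ n) h)) = _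
  rw [← ContinuousLinearMap.adjoint_inner_left, hadj, ContinuousLinearMap.adjoint_inner_right]

/-- If `D T₁* = A₁ D + A₂* D T*`, then `W* (I ⊗ A₁* + M_z ⊗ A₂) = T₁ W*`. -/
lemma IsPureContraction.adjoint_dilationIsometry_comp (hT : IsPureContraction T)
    (hD : ∀ x, ‖D x‖ ^ 2 = ‖x‖ ^ 2 - ‖(T†) x‖ ^ 2) (hc : Commute T₁ T) {A₁ A₂ : F →L[ℂ] F}
    (hA : ∀ h, D ((T₁†) h) = A₁ (D h) + (A₂†) (D ((T†) h))) :
    ((hT.dilationIsometry hD).toContinuousLinearMap†) ∘L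
        (opTensor 1 (A₁†) + opTensor HardySpace.Mz A₂) =
      T₁ ∘L ((hT.dilationIsometry hD).toContinuousLinearMap†) := by
  refine ext_monomial fun n ξ => ?_
  have hn : T₁ ((T ^ n) ((D†) ξ)) = (T ^ n) (T₁ ((D†) ξ)) :=
    DFunLike.congr_fun (hc.pow_right n).eq _
  -- This is the adjoint of the hypothesis `hA`.
  have hξ : T₁ ((D†) ξ) = (D†) ((A₁†) ξ) + T ((D†) (A₂ ξ)) := by
    refine ext_inner_right ℂ fun h => ?_
    rw [inner_add_left, ← ContinuousLinearMap.adjoint_inner_right T₁,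
      ← ContinuousLinearMap.adjoint_inner_right T]
    simp only [ContinuousLinearMap.adjoint_inner_left]
    rw [hA, inner_add_right, ContinuousLinearMap.adjoint_inner_right A₂]
  rw [ContinuousLinearMap.comp_apply, ContinuousLinearMap.comp_apply, add_apply,
    opTensor_elemTensor, opTensor_elemTensor, HardySpace.Mz_monomial, one_apply_eq_self, map_add,
    hT.adjoint_dilationIsometry_monomial, hT.adjoint_dilationIsometry_monomial,
    hT.adjoint_dilationIsometry_monomial, hn, hξ, map_add, pow_succ, mul_apply_eq_comp]

lemma IsPureContraction.adjoint_dilationIsometry_comp_Mz (hT : IsPureContraction T)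
    (hD : ∀ x, ‖D x‖ ^ 2 = ‖x‖ ^ 2 - ‖(T†) x‖ ^ 2) :
    ((hT.dilationIsometry hD).toContinuousLinearMap†) ∘L opTensor HardySpace.Mz 1 =
      T ∘L ((hT.dilationIsometry hD).toContinuousLinearMap†) := by
  refine ext_monomial fun n ξ => ?_
  rw [ContinuousLinearMap.comp_apply, ContinuousLinearMap.comp_apply,
    opTensor_elemTensor, HardySpace.Mz_monomial, one_apply_eq_self,
    hT.adjoint_dilationIsometry_monomial, hT.adjoint_dilationIsometry_monomial, pow_succ',
    mul_apply_eq_comp]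

-- In the series for `W h`, the terms with `n ≥ 1` are `M_z ⊗ I` applied to the series for `W T* h`.
-- The constant term that remains recovers `1 ⊗ D h` from the range of `W`, the key to minimality.
omit [CompleteSpace F] in
lemma IsPureContraction.dilationIsometry_sub (hT : IsPureContraction T)
    (hD : ∀ x, ‖D x‖ ^ 2 = ‖x‖ ^ 2 - ‖(T†) x‖ ^ 2) (h : H) :
    hT.dilationIsometry hD h - opTensor HardySpace.Mz 1 (hT.dilationIsometry hD ((T†) h)) =
      elemTensor (HardySpace.monomial 0) (D h) := by
  have h1 := (hasSum_nat_add_iff' 1).2 (hT.hasSum_dilationIsometry hD h)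
  have h2 := (hT.hasSum_dilationIsometry hD ((T†) h)).mapL
    (opTensor HardySpace.Mz (1 : F →L[ℂ] F))
  have e : ∀ n : ℕ, opTensor HardySpace.Mz (1 : F →L[ℂ] F)
      (elemTensor (HardySpace.monomial n) (D (((T†) ^ n) ((T†) h)))) =
      elemTensor (HardySpace.monomial (n + 1)) (D (((T†) ^ (n + 1)) h)) := fun n => by
    rw [opTensor_elemTensor, HardySpace.Mz_monomial, one_apply_eq_self, pow_succ,
      mul_apply_eq_comp]
  simp only [e] at h2
  rw [← h1.unique h2, Finset.sum_range_one, sub_sub_cancel, pow_zero, one_apply_eq_self]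

omit [CompleteSpace F] in
lemma IsPureContraction.isMinimalDilation (hT : IsPureContraction T)
    (hD : ∀ x, ‖D x‖ ^ 2 = ‖x‖ ^ 2 - ‖(T†) x‖ ^ 2) (hDr : DenseRange D)
    (Q₁ Q₂ : HilbertTensor HardySpace F →L[ℂ] HilbertTensor HardySpace F) :
    IsMinimalDilation (hT.dilationIsometry hD) Q₁ Q₂ (opTensor HardySpace.Mz 1) := by
  set V : HilbertTensor HardySpace F →L[ℂ] HilbertTensor HardySpace F :=
    opTensor HardySpace.Mz 1 with hV
  refine eq_top_of_monomial_mem (Submodule.isClosed_topologicalClosure _) fun n ξ => ?_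
  refine hDr.induction_on ξ ((Submodule.isClosed_topologicalClosure _).preimage
      (elemTensor (HardySpace.monomial n)).continuous) fun h => ?_
  refine Submodule.le_topologicalClosure _ ?_
  have hmem : ∀ (k : ℕ) (x : H), (V ^ k) (hT.dilationIsometry hD x) ∈ Submodule.span ℂ
      {k | ∃ (m₁ m₂ n : ℕ) (h : H),
        k = (Q₁ ^ m₁ * Q₂ ^ m₂ * V ^ n) (hT.dilationIsometry hD h)} :=
    fun k x => Submodule.subset_span ⟨0, 0, k, x, by rw [pow_zero, pow_zero, one_mul, one_mul]⟩
  -- Applying `Vⁿ` to `W h - V W T* h = 1 ⊗ D h` places `zⁿ ⊗ D h` in the span; density of the range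
  -- of `D` does the rest.
  have e : elemTensor (HardySpace.monomial n) (D h) =
      (V ^ n) (hT.dilationIsometry hD h) - (V ^ (n + 1)) (hT.dilationIsometry hD ((T†) h)) := by
    rw [pow_succ, mul_apply_eq_comp, ← map_sub, hV, hT.dilationIsometry_sub,
      opTensor_Mz_pow_monomial, add_zero]
  rw [e]
  exact Submodule.sub_mem _ (hmem _ _) (hmem _ _)

end Dilation

/-! ### Assembly of the dilation theorem -/

lemma adjoint_isometry_apply_self {X Y : Type*} [NormedAddCommGroup X] [InnerProductSpace ℂ X]
    [CompleteSpace X] [NormedAddCommGroup Y] [InnerProductSpace ℂ Y] [CompleteSpace Y]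
    (W : X →ₗᵢ[ℂ] Y) (x : X) : (W.toContinuousLinearMap†) (W x) = x :=
  ext_inner_right ℂ fun y => by
    rw [ContinuousLinearMap.adjoint_inner_left]
    exact W.inner_map_map x y

lemma comp_pow_eq {X Y : Type*} [NormedAddCommGroup X] [NormedSpace ℂ X]
    [NormedAddCommGroup Y] [NormedSpace ℂ Y] {P : X →L[ℂ] Y} {Q : X →L[ℂ] X} {T : Y →L[ℂ] Y}
    (h : P ∘L Q = T ∘L P) (n : ℕ) (x : X) : P ((Q ^ n) x) = (T ^ n) (P x) := by
  induction n generalizing x with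
  | zero => rfl
  | succ n ih =>
    rw [pow_succ, pow_succ, mul_apply_eq_comp, mul_apply_eq_comp, ih,
      ← ContinuousLinearMap.comp_apply P Q, h, ContinuousLinearMap.comp_apply]

lemma exists_minimal_dilation {H F : Type u} [NormedAddCommGroup H] [InnerProductSpace ℂ H]
    [CompleteSpace H] [NormedAddCommGroup F] [InnerProductSpace ℂ F] [CompleteSpace F]
    {T₁ T₂ T : H →L[ℂ] H} (hP : IsPureContraction T) (c₁ : Commute T₁ T) (c₂ : Commute T₂ T)
    {D : H →L[ℂ] F} (hD : ∀ x, ‖D x‖ ^ 2 = ‖x‖ ^ 2 - ‖(T†) x‖ ^ 2) (hDr : DenseRange D)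
    {A₁ A₂ : F →L[ℂ] F} (h₁ : ∀ h, D ((T₁†) h) = A₁ (D h) + (A₂†) (D ((T†) h)))
    (h₂ : ∀ h, D ((T₂†) h) = A₂ (D h) + (A₁†) (D ((T†) h)))
    {Q₁ Q₂ V : HilbertTensor HardySpace F →L[ℂ] HilbertTensor HardySpace F}
    (hQ₁ : Q₁ = opTensor 1 (A₁†) + opTensor HardySpace.Mz A₂)
    (hQ₂ : Q₂ = opTensor 1 (A₂†) + opTensor HardySpace.Mz A₁)
    (hV : V = opTensor HardySpace.Mz 1) (hiso : IsEIsometry Q₁ Q₂ V) :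
    IsPureEIsometry Q₁ Q₂ V ∧
      ∃ W : H →ₗᵢ[ℂ] HilbertTensor HardySpace F,
        IsEIsometricDilation W T₁ T₂ T Q₁ Q₂ V ∧ IsMinimalDilation W Q₁ Q₂ V := by
  have i1 := hP.adjoint_dilationIsometry_comp hD c₁ h₁
  have i2 := hP.adjoint_dilationIsometry_comp hD c₂ h₂
  have i3 := hP.adjoint_dilationIsometry_comp_Mz hD
  rw [← hQ₁] at i1
  rw [← hQ₂] at i2
  rw [← hV] at i3
  refine ⟨⟨hiso, hV ▸ isometry_opTensor_Mz, hV ▸ isPureContraction_opTensor_Mz⟩,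
    hP.dilationIsometry hD, ⟨hiso, fun m₁ m₂ n h => ?_⟩,
    hV ▸ hP.isMinimalDilation hD hDr Q₁ Q₂⟩
  rw [mul_apply_eq_comp, mul_apply_eq_comp, comp_pow_eq i1, comp_pow_eq i2, comp_pow_eq i3,
    adjoint_isometry_apply_self]
  rfl

end Tetrablock

theorem theorem3p2 {H : Type u} [NormedAddCommGroup H] [InnerProductSpace ℂ H] [CompleteSpace H]
    (T₁ T₂ T : H →L[ℂ] H) (hT : IsPureEContraction T₁ T₂ T)
    (A₁ A₂ : defectSpace (T†) →L[ℂ] defectSpace (T†))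
    (hA : AreFundamentalOperators (T₁†) (T₂†) (T†) A₁ A₂)
    (hcomm : A₁ * A₂ = A₂ * A₁)
    (hbracket : A₁† * A₁ - A₁ * A₁† = A₂† * A₂ - A₂ * A₂†)
    (Q₁ Q₂ V : HilbertTensor HardySpace (defectSpace (T†)) →L[ℂ]
      HilbertTensor HardySpace (defectSpace (T†)))
    (hQ₁ : Q₁ = opTensor 1 (A₁†) + opTensor HardySpace.Mz A₂)
    (hQ₂ : Q₂ = opTensor 1 (A₂†) + opTensor HardySpace.Mz A₁)
    (hV : V = opTensor HardySpace.Mz 1) :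
    IsPureEIsometry Q₁ Q₂ V ∧
      ∃ W : H →ₗᵢ[ℂ] HilbertTensor HardySpace (defectSpace (T†)),
        IsEIsometricDilation W T₁ T₂ T Q₁ Q₂ V ∧ IsMinimalDilation W Q₁ Q₂ V := by
  obtain ⟨hE, hP⟩ := hT
  obtain ⟨-, c13, c23⟩ := hE.commuting
  have hT' : ‖T†‖ ≤ 1 := (norm_adjoint T).trans_le hP.1
  have hA' : AreFundamentalOperators (T₂†) (T₁†) (T†) A₂ A₁ := ⟨hA.2, hA.1⟩
  have hiso : IsEIsometry Q₁ Q₂ V := by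
    rw [hQ₁, hQ₂, hV]
    exact isEIsometry_pencil hcomm hbracket fun z w hz hw ξ =>
      hE.re_inner_fundamentalOperators_le hP.1 hA hz hw ξ
  exact exists_minimal_dilation hP c13 c23 (D := defectMap (T†)) (norm_defectOp_sq hT')
    (denseRange_defectMap _) (hA.defectMap_adjoint hP.1 c13) (hA'.defectMap_adjoint hP.1 c23)
    hQ₁ hQ₂ hV hiso
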